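/- **Setting.** Let $(X,Y)$ be a pair of real-valued random variables with law arbitrary except that $Y$ is not almost surely constant, and let $\mu$ be the law of $Y$. Define $$\xi(X,Y):=\frac{\int \mathrm{Var}\bigl(\mathbb{E}(1_{\{Y\ge t\}}\mid X)\bigr)\,d\mu(t)}{\int \mathrm{Var}(1_{\{Y\ge t\}})\,d\mu(t)} .$$ Let $(X_1,Y_1),(X_2,Y_2),\ldots$ be i.i.d. pairs with the same law as $(X,Y)$. For each $n\ge 2$, rearrange the first $n$ pairs as $(X_{(1)},Y_{(1)}),\ldots,(X_{(n)},Y_{(n)})$ with $X_{(1)}\le\cdots\le X_{(n)}$, ties among the $X_i$ being broken uniformly at random; that is, conditionally on $(X_1,Y_1),\ldots,(X_n,Y_n)$, the rearranging permutation is uniformly distributed on the set of all permutations of $\{1,\ldots,n\}$ that put $X_1,\ldots,X_n$ in nondecreasing order (nothing is assumed about the joint law of the tie-breaking for different $n$). Let $r_i:=\#\{j: Y_{(j)}\le Y_{(i)}\}$ and $l_i:=\#\{j:Y_{(j)}\ge Y_{(i)}\}$, and define $$\xi_n(X,Y):=1-\frac{n\sum_{i=1}^{n-1}|r_{i+1}-r_i|}{2\sum_{i=1}^n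 l_i(n-l_i)}$$ (with an arbitrary convention when the denominator vanishes, which almost surely happens for only finitely many $n$). **Theorem.** Both integrals in the definition of $\xi(X,Y)$ are well defined and finite, and the denominator is positive. As $n\to\infty$, $\xi_n(X,Y)$ converges almost surely to the deterministic limit $\xi(X,Y)$. This limit belongs to $[0,1]$. It is $0$ if and only if $X$ and $Y$ are independent, and it is $1$ if and only if there is a measurable function $f:\mathbb{R}\to\mathbb{R}$ such that $Y=f(X)$ almost surely. -/

import Mathlib

open MeasureTheory ProbabilityTheory

namespace RankCorr

/-- The indicator random variable `1_{Y ≥ t}`. -/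
noncomputable def upInd {Ω : Type*} (Y : Ω → ℝ) (t : ℝ) : Ω → ℝ :=
  Set.indicator {ω | t ≤ Y ω} (fun _ => (1 : ℝ))

/-- `Var(E(1_{Y ≥ t} | X))`, the conditional expectation being given the `σ`-algebra generated
by `X`. -/
noncomputable def varCond {Ω : Type*} [MeasurableSpace Ω] (P : Measure Ω) (X Y : Ω → ℝ)
    (t : ℝ) : ℝ :=
  variance (P[upInd Y t | MeasurableSpace.comap X inferInstance]) P

/-- `Var(1_{Y ≥ t})`. -/
noncomputable def varInd {Ω : Type*} [MeasurableSpace Ω] (P : Measure Ω) (Y : Ω → ℝ)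
    (t : ℝ) : ℝ :=
  variance (upInd Y t) P

/-- The dependence measure `ξ(X, Y)`; both integrals are with respect to the law of `Y`. -/
noncomputable def xi {Ω : Type*} [MeasurableSpace Ω] (P : Measure Ω) (X Y : Ω → ℝ) : ℝ :=
  (∫ t, varCond P X Y t ∂(P.map Y)) / (∫ t, varInd P Y t ∂(P.map Y))

/-- The permutation `p` lists the sample points in increasing order of `x`:
`x (p 0) ≤ x (p 1) ≤ … ≤ x (p (n - 1))`. -/
def IsIncreasingRearrangement {n : ℕ} (x : Fin n → ℝ) (p : Equiv.Perm (Fin n)) : Prop :=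
  Monotone fun i => x (p i)

/-- `r_i`, the number of `j` such that `Y_(j) ≤ Y_(i)`, where `Y_(i) = y (p i)`. -/
noncomputable def rankLe {n : ℕ} (y : Fin n → ℝ) (p : Equiv.Perm (Fin n)) (i : Fin n) : ℕ :=
  (Finset.univ.filter fun j : Fin n => y (p j) ≤ y (p i)).card

/-- `l_i`, the number of `j` such that `Y_(j) ≥ Y_(i)`, where `Y_(i) = y (p i)`. -/
noncomputable def rankGe {n : ℕ} (y : Fin n → ℝ) (p : Equiv.Perm (Fin n)) (i : Fin n) : ℕ :=
  (Finset.univ.filter fun j : Fin n => y (p i) ≤ y (p j)).card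

/-- The coefficient `ξ_n` of a sample of size `n` with `y`-values `y`, computed from the
rearrangement `p` (which carries the dependence on the `x`-values):
`1 - n ∑_{i=1}^{n-1} |r_{i+1} - r_i| / (2 ∑_{i=1}^n l_i (n - l_i))`. -/
noncomputable def xiN {n : ℕ} (y : Fin n → ℝ) (p : Equiv.Perm (Fin n)) : ℝ :=
  1 - (n * ∑ i : Fin n, if h : (i : ℕ) + 1 < n then
          |(rankLe y p ⟨(i : ℕ) + 1, h⟩ : ℝ) - (rankLe y p i : ℝ)| else 0) /
      (2 * ∑ i : Fin n, (rankGe y p i : ℝ) * ((n : ℝ) - (rankGe y p i : ℝ)))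

open Classical in
/-- The random permutation `σ` is an increasing rearrangement of the random vector `x`, with ties
broken uniformly at random: given the sample `(x, y)`, its conditional law is the uniform
distribution on the set of all increasing rearrangements of `x`. -/
structure IsUniformRearrangement {Ω : Type*} [MeasurableSpace Ω] (P : Measure Ω) {n : ℕ}
    (x y : Ω → Fin n → ℝ) (σ : Ω → Equiv.Perm (Fin n)) : Prop where
  measurableSet_eq : ∀ p, MeasurableSet {ω | σ ω = p}
  condProb_eq : ∀ p,
    P[Set.indicator {ω | σ ω = p} (fun _ => (1 : ℝ)) |
        MeasurableSpace.comap (fun ω => (x ω, y ω)) inferInstance]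
      =ᵐ[P] fun ω => if IsIncreasingRearrangement (x ω) p then
          1 / (Set.ncard {q | IsIncreasingRearrangement (x ω) q} : ℝ) else 0

end RankCorr

/-!
Almost sure convergence of the rank coefficient `ξ_n` and the extreme values of its limit `ξ`.

Write `μ` for the law of `Y`, `F y = μ (-∞, y]`, and `q t x` for a regular conditional probability
of `Y ≥ t` given `X = x`. By the law of total variance, the numerator of `ξ` is its denominator
`∫ Var(1_{Y ≥ t}) dμ(t)` minus `N = ∫ E[q t X (1 - q t X)] dμ(t)`. Since the normalized sum
`∑ l_i (n - l_i) / n³` converges to the denominator of `ξ`, what has to be shown is that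
`∑ |r_{i+1} - r_i| / n²` converges almost surely to `2 N`.

* By the Glivenko–Cantelli theorem (`tendsto_countLe_uniform`) the normalized ranks `r_i / n` may be
  replaced by `F (Y_(i))`, so the sum becomes the average of `|F (Y_(i+1)) - F (Y_(i))|`.
* Given the `x`-values and the rearrangement, the `Y_(i)` are independent, as the rearrangement
  depends on the sample only through the `x`-values. Splitting the neighbouring pairs by parity
  gives two sums of independent bounded variables, and Hoeffding's inequality (`adjSum_deviation`)
  together with the Borel–Cantelli lemma allows the average to be replaced by its conditional mean
  (`tendsto_adjSum_sub_pairMean`). The bounds are summable in `n`, so nothing is needed about the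
  joint law of the rearrangements for different `n`. Fixing the `x`-values is made rigorous by
  generating each `Y_i` from `X_i` and an independent uniform variable (`map_sample_eq`).
* The conditional mean is the average of `∫ (q t x + q t x' - 2 q t x q t x') dμ(t)` over
  neighbouring values `x = X_(i)`, `x' = X_(i+1)`. For every bounded Borel function `ψ` the
  average of `|ψ (X_(i+1)) - ψ (X_(i))|` tends to zero (`oscVanishes_of_bounded`): for the indicator
  of a half-line the sum is at most one, and the property is stable under approximation in `L¹`. So
  `x'` may be replaced by `x`, and the strong law of large numbers gives the limit `2 N`
  (`tendsto_adjSum_pairMean`).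

If `ξ = 0`, then `q t X` is constant for `μ`-almost every `t`; if `ξ = 1`, then `N = 0`, so `q t X`
is zero or one for `μ`-almost every `t`. Both facts pass to every `t` by inner regularity of `μ`
(`le_zero_of_ae_eq_zero`). The first is independence; the second makes almost every conditional law
of `Y` given `X` a point mass, whose position is the required function of `X`.
-/

namespace RankCorr

open Filter Topology

/-! ### Sums over consecutive indices -/

/-- The sum `∑ f i (i + 1)` over consecutive pairs of indices in `Fin n`. -/
noncomputable def adjSum {n : ℕ} (f : Fin n → Fin n → ℝ) : ℝ :=
  ∑ i : Fin n, if h : (i : ℕ) + 1 < n then f i ⟨(i : ℕ) + 1, h⟩ else 0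

lemma adjSum_le {n : ℕ} {f g : Fin n → Fin n → ℝ} (h : ∀ i j : Fin n, f i j ≤ g i j) :
    adjSum f ≤ adjSum g := by
  refine Finset.sum_le_sum fun i _ => ?_
  split_ifs
  · exact h _ _
  · exact le_rfl

lemma adjSum_nonneg {n : ℕ} {f : Fin n → Fin n → ℝ} (h : ∀ i j : Fin n, 0 ≤ f i j) :
    0 ≤ adjSum f := by
  refine Finset.sum_nonneg fun i _ => ?_
  split_ifs
  · exact h _ _
  · exact le_rfl

lemma adjSum_add {n : ℕ} (f g : Fin n → Fin n → ℝ) :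
    adjSum (fun i j => f i j + g i j) = adjSum f + adjSum g := by
  unfold adjSum
  rw [← Finset.sum_add_distrib]
  refine Finset.sum_congr rfl fun i _ => ?_
  split_ifs <;> simp

lemma adjSum_sub {n : ℕ} (f g : Fin n → Fin n → ℝ) :
    adjSum (fun i j => f i j - g i j) = adjSum f - adjSum g := by
  unfold adjSum
  rw [← Finset.sum_sub_distrib]
  refine Finset.sum_congr rfl fun i _ => ?_
  split_ifs <;> simp

lemma adjSum_mul_left {n : ℕ} (c : ℝ) (f : Fin n → Fin n → ℝ) :
    adjSum (fun i j => c * f i j) = c * adjSum f := by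
  unfold adjSum
  rw [Finset.mul_sum]
  refine Finset.sum_congr rfl fun i _ => ?_
  split_ifs <;> simp

lemma adjSum_div {n : ℕ} (f : Fin n → Fin n → ℝ) (c : ℝ) :
    adjSum (fun i j => f i j / c) = adjSum f / c := by
  simp_rw [div_eq_inv_mul, adjSum_mul_left]

lemma abs_adjSum_le {n : ℕ} (f : Fin n → Fin n → ℝ) :
    |adjSum f| ≤ adjSum fun i j => |f i j| := by
  refine (Finset.abs_sum_le_sum_abs _ _).trans (Finset.sum_le_sum fun i _ => ?_)
  split_ifs <;> simp

lemma adjSum_const_le {n : ℕ} {c : ℝ} (hc : 0 ≤ c) :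
    adjSum (fun _ _ : Fin n => c) ≤ n * c := by
  have : adjSum (fun _ _ : Fin n => c) ≤ ∑ _i : Fin n, c := by
    refine Finset.sum_le_sum fun i _ => ?_
    split_ifs <;> simp [hc]
  simpa using this

/-- A sum over consecutive pairs as a sum over natural numbers. -/
lemma adjSum_eq_sum_range {n : ℕ} (f : Fin n → Fin n → ℝ) :
    adjSum f = ∑ i ∈ Finset.range n,
      if h : i + 1 < n then f ⟨i, by omega⟩ ⟨i + 1, h⟩ else 0 := by
  rw [Finset.sum_range]
  rfl

lemma adjSum_left_le {n : ℕ} {g : Fin n → ℝ} (hg : ∀ i, 0 ≤ g i) :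
    adjSum (fun i _ => g i) ≤ ∑ i, g i := by
  refine Finset.sum_le_sum fun i _ => ?_
  split_ifs
  · exact le_rfl
  · exact hg i

lemma adjSum_left_ge {n : ℕ} {g : Fin n → ℝ} {c : ℝ} (hc : 0 ≤ c) (hg : ∀ i, g i ≤ c) :
    ∑ i, g i ≤ adjSum (fun i _ => g i) + c := by
  cases n with
  | zero => simpa [adjSum] using hc
  | succ n =>
    unfold adjSum
    rw [Fin.sum_univ_castSucc, Fin.sum_univ_castSucc]
    have h : ∀ i : Fin n, (if h : (i.castSucc : ℕ) + 1 < n + 1 then g i.castSucc else 0)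
        = g i.castSucc := fun i => dif_pos (by simp)
    simp only [h]
    have := hg (Fin.last n)
    simp only [Fin.val_last, lt_self_iff_false, dite_false]
    linarith

lemma adjSum_right_le {n : ℕ} {g : Fin n → ℝ} (hg : ∀ i, 0 ≤ g i) :
    adjSum (fun _ j => g j) ≤ ∑ i, g i := by
  cases n with
  | zero => simp [adjSum]
  | succ n =>
    unfold adjSum
    rw [Fin.sum_univ_castSucc, Fin.sum_univ_succ g]
    have h : ∀ i : Fin n, (if h : (i.castSucc : ℕ) + 1 < n + 1 then
        g ⟨(i.castSucc : ℕ) + 1, h⟩ else 0) = g i.succ := fun i => by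
      rw [dif_pos (by simp)]; rfl
    simp only [h]
    simp only [Fin.val_last, lt_self_iff_false, dite_false]
    linarith [hg 0]

/-- Along an increasing enumeration, the oscillation of the indicator of a half-line is at
most one. -/
lemma adjSum_abs_indicator_Iic_le {n : ℕ} {x : Fin n → ℝ} (hx : Monotone x) (a : ℝ) :
    adjSum (fun i j => |(Set.Iic a).indicator (fun _ => (1 : ℝ)) (x j)
      - (Set.Iic a).indicator (fun _ => (1 : ℝ)) (x i)|) ≤ 1 := by
  set g : ℝ → ℝ := (Set.Iic a).indicator (fun _ => (1 : ℝ)) with hg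
  have hanti : Antitone g := by
    intro u v huv
    simp only [hg, Set.indicator_apply, Set.mem_Iic]
    split_ifs <;> first | (exfalso; linarith) | norm_num
  have h01 : ∀ u, g u ∈ Set.Icc (0 : ℝ) 1 := by
    intro u
    simp only [hg, Set.indicator_apply]
    split_ifs <;> simp
  cases n with
  | zero => simp [adjSum]
  | succ n =>
    unfold adjSum
    rw [Fin.sum_univ_castSucc]
    have h : ∀ i : Fin n, (if h : (i.castSucc : ℕ) + 1 < n + 1 then
        |g (x ⟨(i.castSucc : ℕ) + 1, h⟩) - g (x i.castSucc)| else 0)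
        = g (x i.castSucc) - g (x i.succ) := fun i => by
      rw [dif_pos (by simp), abs_of_nonpos]
      · rw [neg_sub]; rfl
      · exact sub_nonpos.2 (hanti (hx (Fin.le_def.2 (by simp))))
    simp only [h]
    simp only [Fin.val_last, lt_self_iff_false, dite_false]
    have htel : ∑ i : Fin n, (g (x i.castSucc) - g (x i.succ)) = g (x 0) - g (x (Fin.last n)) := by
      have h1 := Fin.sum_univ_castSucc (fun i : Fin (n+1) => g (x i))
      have h2 := Fin.sum_univ_succ (fun i : Fin (n+1) => g (x i))
      rw [Finset.sum_sub_distrib]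
      linarith
    rw [htel]
    linarith [(h01 (x 0)).2, (h01 (x (Fin.last n))).1]

/-! ### Concentration of sums over consecutive pairs -/

section Concentration

variable {Ω : Type*} [MeasurableSpace Ω] {P : Measure Ω} {n : ℕ}

/-- Functions of disjoint blocks of independent variables are independent. -/
lemma indepFun_of_agree {η : Fin n → Ω → ℝ} (hη : iIndepFun η P) (hm : ∀ i, Measurable (η i))
    {A B : (Fin n → ℝ) → ℝ} (hA : Measurable A) (hB : Measurable B) (T : Finset (Fin n))
    (hAT : ∀ v w : Fin n → ℝ, (∀ j ∈ T, v j = w j) → A v = A w)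
    (hBT : ∀ v w : Fin n → ℝ, (∀ j ∉ T, v j = w j) → B v = B w) :
    IndepFun (fun ω => A fun j => η j ω) (fun ω => B fun j => η j ω) P := by
  have h := hη.indepFun_finset T Tᶜ disjoint_compl_right hm
  have ext_meas : ∀ S : Finset (Fin n),
      Measurable fun (v : S → ℝ) (j : Fin n) => if h : j ∈ S then v ⟨j, h⟩ else (0 : ℝ) := by
    intro S
    refine measurable_pi_lambda _ fun j => ?_
    by_cases hj : j ∈ S
    · simp only [hj, dite_true]; exact measurable_pi_apply _
    · simp only [hj, dite_false]; exact measurable_const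
  have h2 := h.comp (hA.comp (ext_meas T)) (hB.comp (ext_meas Tᶜ))
  convert h2 using 1
  · ext ω
    refine hAT _ _ fun j hj => ?_
    simp [hj]
  · ext ω
    refine hBT _ _ fun j hj => ?_
    simp [hj]

/-- The contribution of the `k`-th block `{2 k + b, 2 k + b + 1}` to a sum over consecutive pairs;
`b = 0` and `b = 1` give the two parities. -/
noncomputable def blockTerm (f : ℝ → ℝ → ℝ) (b : ℕ) (v : Fin n → ℝ) (k : ℕ) : ℝ :=
  if h : 2 * k + b + 1 < n then f (v ⟨2 * k + b, by omega⟩) (v ⟨2 * k + b + 1, h⟩) else 0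

lemma measurable_blockTerm {f : ℝ → ℝ → ℝ} (hf : Measurable (Function.uncurry f)) (b k : ℕ) :
    Measurable fun v : Fin n → ℝ => blockTerm f b v k := by
  unfold blockTerm
  split_ifs
  · exact hf.comp (f := fun v : Fin n → ℝ => (v _, v _))
      ((measurable_pi_apply _).prodMk (measurable_pi_apply _))
  · exact measurable_const

lemma blockTerm_mem_Icc {f : ℝ → ℝ → ℝ} (hf : ∀ u v, f u v ∈ Set.Icc (0 : ℝ) 1) (b k : ℕ)
    (v : Fin n → ℝ) : blockTerm f b v k ∈ Set.Icc (0 : ℝ) 1 := by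
  unfold blockTerm
  split_ifs
  · exact hf _ _
  · simp

lemma adjSum_eq_blockTerm (f : ℝ → ℝ → ℝ) (v : Fin n → ℝ) :
    adjSum (fun i j => f (v i) (v j)) =
      ∑ k ∈ Finset.range n, blockTerm f 0 v k + ∑ k ∈ Finset.range n, blockTerm f 1 v k := by
  rw [adjSum_eq_sum_range]
  set w : ℕ → ℝ := fun i => if h : i + 1 < n then f (v ⟨i, by omega⟩) (v ⟨i + 1, h⟩) else 0
    with hw
  have h1 : ∑ i ∈ Finset.range n, w i = ∑ i ∈ Finset.range (2 * n), w i := by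
    refine Finset.sum_subset (Finset.range_mono (by omega)) fun i _ hi => ?_
    have hi' : ¬ i + 1 < n := by simp at hi; omega
    simp [hw, hi']
  have h2 : ∀ m : ℕ, ∑ i ∈ Finset.range (2 * m), w i =
      ∑ k ∈ Finset.range m, w (2 * k) + ∑ k ∈ Finset.range m, w (2 * k + 1) := by
    intro m
    induction m with
    | zero => simp
    | succ m ih =>
      rw [show 2 * (m + 1) = 2 * m + 1 + 1 by ring, Finset.sum_range_succ, Finset.sum_range_succ,
        ih, Finset.sum_range_succ, Finset.sum_range_succ]
      ring
  rw [h1, h2]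
  rfl

/-- Since different blocks of one parity are disjoint, their contributions add up to a
sub-Gaussian variable with variance proxy proportional to the number of blocks. -/
lemma hasSubgaussianMGF_blockSum [IsProbabilityMeasure P] {η : Fin n → Ω → ℝ} (hη : iIndepFun η P)
    (hm : ∀ i, Measurable (η i)) {f : ℝ → ℝ → ℝ} (hf : Measurable (Function.uncurry f))
    (hf01 : ∀ u v, f u v ∈ Set.Icc (0 : ℝ) 1) (b m : ℕ) :
    HasSubgaussianMGF (fun ω => ∑ k ∈ Finset.range m, (blockTerm f b (fun j => η j ω) k
      - ∫ ω', blockTerm f b (fun j => η j ω') k ∂P)) (m * (1 / 2) ^ 2) P := by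
  have hmη : Measurable fun ω (j : Fin n) => η j ω := measurable_pi_lambda _ hm
  induction m with
  | zero => simp
  | succ m ih =>
    have hlast : HasSubgaussianMGF (fun ω => blockTerm f b (fun j => η j ω) m
        - ∫ ω', blockTerm f b (fun j => η j ω') m ∂P) ((1 / 2) ^ 2) P := by
      have := hasSubgaussianMGF_of_mem_Icc (μ := P) (a := 0) (b := 1)
        (X := fun ω => blockTerm f b (fun j => η j ω) m)
        ((measurable_blockTerm hf b m).comp hmη).aemeasurable
        (ae_of_all _ fun ω => blockTerm_mem_Icc hf01 b m _)
      simpa using this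
    have hind : IndepFun (fun ω => ∑ k ∈ Finset.range m, (blockTerm f b (fun j => η j ω) k
        - ∫ ω', blockTerm f b (fun j => η j ω') k ∂P))
        (fun ω => blockTerm f b (fun j => η j ω) m
        - ∫ ω', blockTerm f b (fun j => η j ω') m ∂P) P := by
      refine indepFun_of_agree (A := fun v => ∑ k ∈ Finset.range m, (blockTerm f b v k
        - ∫ ω', blockTerm f b (fun j => η j ω') k ∂P))
        (B := fun v => blockTerm f b v m - ∫ ω', blockTerm f b (fun j => η j ω') m ∂P) hη hm
        (Finset.measurable_sum _ fun k _ => (measurable_blockTerm hf b k).sub_const _)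
        ((measurable_blockTerm hf b m).sub_const _)
        (Finset.univ.filter fun j : Fin n => (j : ℕ) < 2 * m + b) ?_ ?_
      · intro v w hvw
        refine Finset.sum_congr rfl fun k hk => ?_
        have hk' := Finset.mem_range.1 hk
        simp only [blockTerm]
        split_ifs with h
        · rw [hvw _ (by simp; omega), hvw _ (by simp; omega)]
        · rfl
      · intro v w hvw
        simp only [blockTerm]
        split_ifs with h
        · rw [hvw _ (by simp), hvw _ (by simp)]
        · rfl
    have := ih.add_of_indepFun hlast hind
    simp only [Finset.sum_range_succ]
    convert this using 1
    push_cast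
    ring

lemma blockSum_deviation [IsProbabilityMeasure P] {η : Fin n → Ω → ℝ} (hη : iIndepFun η P)
    (hm : ∀ i, Measurable (η i)) {f : ℝ → ℝ → ℝ} (hf : Measurable (Function.uncurry f))
    (hf01 : ∀ u v, f u v ∈ Set.Icc (0 : ℝ) 1) (b : ℕ) {ε : ℝ} (hε : 0 ≤ ε) :
    P.real {ω | ε * n ≤ |∑ k ∈ Finset.range n, (blockTerm f b (fun j => η j ω) k
      - ∫ ω', blockTerm f b (fun j => η j ω') k ∂P)|} ≤ 2 * Real.exp (-(2 * ε ^ 2 * n)) := by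
  have h := hasSubgaussianMGF_blockSum hη hm hf hf01 b n
  have hεn : 0 ≤ ε * n := by positivity
  have h1 := h.measure_ge_le hεn
  have h2 := h.neg.measure_ge_le hεn
  have hexp : -(ε * n) ^ 2 / (2 * (((n : NNReal) * (1 / 2) ^ 2 : NNReal) : ℝ))
      = -(2 * ε ^ 2 * n) := by
    rcases Nat.eq_zero_or_pos n with hn | hn
    · simp [hn]
    · have : (n : ℝ) ≠ 0 := by positivity
      push_cast
      field_simp
  rw [hexp] at h1 h2
  rw [two_mul (Real.exp _)]
  refine le_trans ?_ (add_le_add h1 h2)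
  refine le_trans (measureReal_mono ?_ (measure_ne_top _ _)) (measureReal_union_le _ _)
  intro ω hω
  rcases le_abs.1 (Set.mem_ofPred_eq ▸ hω) with h | h
  · exact Or.inl h
  · exact Or.inr h

/-- Sums over consecutive pairs of independent variables concentrate around their mean at an
exponential rate. -/
lemma adjSum_deviation [IsProbabilityMeasure P] {η : Fin n → Ω → ℝ} (hη : iIndepFun η P)
    (hm : ∀ i, Measurable (η i)) {f : ℝ → ℝ → ℝ} (hf : Measurable (Function.uncurry f))
    (hf01 : ∀ u v, f u v ∈ Set.Icc (0 : ℝ) 1) {ε : ℝ} (hε : 0 ≤ ε) :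
    P.real {ω | ε * n ≤ |adjSum (fun i j => f (η i ω) (η j ω))
      - adjSum (fun i j => ∫ ω', f (η i ω') (η j ω') ∂P)|} ≤ 4 * Real.exp (-(ε ^ 2 / 2 * n)) := by
  have hmean : adjSum (fun i j => ∫ ω', f (η i ω') (η j ω') ∂P)
      = ∑ k ∈ Finset.range n, ∫ ω', blockTerm f 0 (fun j => η j ω') k ∂P
        + ∑ k ∈ Finset.range n, ∫ ω', blockTerm f 1 (fun j => η j ω') k ∂P := by
    have hmη : Measurable fun ω (j : Fin n) => η j ω := measurable_pi_lambda _ hm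
    have hi : ∀ b k, Integrable (fun ω => blockTerm f b (fun j => η j ω) k) P := fun b k =>
      Integrable.of_mem_Icc 0 1 ((measurable_blockTerm hf b k).comp hmη).aemeasurable
        (ae_of_all _ fun ω => blockTerm_mem_Icc hf01 b k _)
    have hi' : ∀ i j : Fin n, Integrable (fun ω => f (η i ω) (η j ω)) P := fun i j =>
      Integrable.of_mem_Icc 0 1 (hf.comp ((hm i).prodMk (hm j))).aemeasurable
        (ae_of_all _ fun ω => hf01 _ _)
    rw [← integral_finsetSum _ fun k _ => hi 0 k, ← integral_finsetSum _ fun k _ => hi 1 k,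
      ← integral_add (integrable_finsetSum _ fun k _ => hi 0 k)
        (integrable_finsetSum _ fun k _ => hi 1 k)]
    simp_rw [← adjSum_eq_blockTerm]
    unfold adjSum
    rw [integral_finsetSum]
    · refine Finset.sum_congr rfl fun i _ => ?_
      split_ifs
      · rfl
      · simp
    · intro i _
      split_ifs
      · exact hi' _ _
      · exact integrable_zero _ _ _
  have h0 := blockSum_deviation hη hm hf hf01 0 (ε := ε / 2) (by positivity)
  have h1 := blockSum_deviation hη hm hf hf01 1 (ε := ε / 2) (by positivity)
  have hexp : -(2 * (ε / 2) ^ 2 * n) = -(ε ^ 2 / 2 * n) := by ring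
  rw [hexp] at h0 h1
  refine le_trans ?_ (le_of_le_of_eq (add_le_add h0 h1) (by ring))
  refine le_trans (measureReal_mono ?_ (measure_ne_top _ _)) (measureReal_union_le _ _)
  intro ω hω
  by_contra hcon
  rw [Set.mem_union, not_or] at hcon
  simp only [Set.mem_ofPred_eq, not_le] at hcon hω
  rw [adjSum_eq_blockTerm f fun j => η j ω, hmean] at hω
  simp only [Finset.sum_sub_distrib] at hcon
  have := abs_add_le (∑ k ∈ Finset.range n, blockTerm f 0 (fun j => η j ω) k
      - ∑ k ∈ Finset.range n, ∫ ω', blockTerm f 0 (fun j => η j ω') k ∂P)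
    (∑ k ∈ Finset.range n, blockTerm f 1 (fun j => η j ω) k
      - ∑ k ∈ Finset.range n, ∫ ω', blockTerm f 1 (fun j => η j ω') k ∂P)
  rw [add_sub_add_comm] at hω
  linarith [hcon.1, hcon.2]

end Concentration

/-! ### Oscillation along the order statistics -/

section Oscillation

variable {Ω : Type*} [MeasurableSpace Ω] {P : Measure Ω}

/-- The strong law of large numbers for bounded functions of a sample. -/
lemma tendsto_sample_mean {E : Type*} [MeasurableSpace E] {Zs : ℕ → Ω → E} {ν : Measure E}
    [IsProbabilityMeasure P] (hm : ∀ i, Measurable (Zs i)) (hind : iIndepFun Zs P)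
    (hlaw : ∀ i, P.map (Zs i) = ν) {h : E → ℝ} (hh : Measurable h) {C : ℝ}
    (hC : ∀ z, |h z| ≤ C) :
    ∀ᵐ ω ∂P, Tendsto (fun n : ℕ => (∑ i : Fin n, h (Zs i ω)) / n) atTop (𝓝 (∫ z, h z ∂ν)) := by
  have hint : Integrable (fun ω => h (Zs 0 ω)) P :=
    Integrable.of_bound (hh.comp (hm 0)).aestronglyMeasurable C (ae_of_all _ fun ω => hC _)
  have hid : ∀ i, IdentDistrib (fun ω => h (Zs i ω)) (fun ω => h (Zs 0 ω)) P P := fun i =>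
    IdentDistrib.comp ⟨(hm i).aemeasurable, (hm 0).aemeasurable, by rw [hlaw, hlaw]⟩ hh
  have hpair : Pairwise (Function.onFun (fun f g => IndepFun f g P)
      (fun (i : ℕ) ω => h (Zs i ω))) := fun i j hij => (hind.indepFun hij).comp hh hh
  have := strong_law_ae_real (fun i ω => h (Zs i ω)) hint hpair hid
  have hmean : ∫ ω, h (Zs 0 ω) ∂P = ∫ z, h z ∂ν := by
    rw [← hlaw 0, integral_map (hm 0).aemeasurable hh.aestronglyMeasurable]
  simp only [hmean] at this
  filter_upwards [this] with ω hω
  refine hω.congr fun n => ?_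
  rw [Finset.sum_range]

/-- The average oscillation of `ψ` along the enumeration of the first `n` of the `Xs` by `σ n`
tends to zero almost surely. -/
def OscVanishes (P : Measure Ω) (Xs : ℕ → Ω → ℝ) (σ : (n : ℕ) → Ω → Equiv.Perm (Fin n))
    (ψ : ℝ → ℝ) : Prop :=
  ∀ᵐ ω ∂P, Tendsto (fun n : ℕ => adjSum (fun i j : Fin n =>
    |ψ (Xs (σ n ω j) ω) - ψ (Xs (σ n ω i) ω)|) / n) atTop (𝓝 0)

variable {Xs : ℕ → Ω → ℝ} {σ : (n : ℕ) → Ω → Equiv.Perm (Fin n)} {ψ φ : ℝ → ℝ}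

lemma OscVanishes.add (hψ : OscVanishes P Xs σ ψ) (hφ : OscVanishes P Xs σ φ) :
    OscVanishes P Xs σ fun x => ψ x + φ x := by
  filter_upwards [hψ, hφ] with ω h1 h2
  refine squeeze_zero (fun n => ?_) (fun n => ?_) (by simpa using h1.add h2)
  · exact div_nonneg (adjSum_nonneg fun _ _ => abs_nonneg _) n.cast_nonneg
  · rw [← add_div, ← adjSum_add]
    refine div_le_div_of_nonneg_right (adjSum_le fun i j => ?_) n.cast_nonneg
    rw [add_sub_add_comm]
    exact abs_add_le _ _

lemma OscVanishes.const_mul (hψ : OscVanishes P Xs σ ψ) (c : ℝ) :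
    OscVanishes P Xs σ fun x => c * ψ x := by
  filter_upwards [hψ] with ω h1
  have h2 := h1.const_mul |c|
  rw [mul_zero] at h2
  refine h2.congr fun n => ?_
  rw [← mul_div_assoc, ← adjSum_mul_left]
  simp_rw [← abs_mul, mul_sub]

lemma oscVanishes_const (c : ℝ) : OscVanishes P Xs σ fun _ => c := by
  refine ae_of_all _ fun ω => ?_
  simp [adjSum]

/-- Functions of vanishing oscillation are closed under approximation in `L¹` of the law of the
sample, since the strong law controls the average error of the approximation. -/
lemma OscVanishes.of_approx [IsProbabilityMeasure P] {μX : Measure ℝ} [IsProbabilityMeasure μX]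
    (hm : ∀ i, Measurable (Xs i)) (hind : iIndepFun Xs P) (hlaw : ∀ i, P.map (Xs i) = μX)
    {C : ℝ} {ψs : ℕ → ℝ → ℝ} (hψ : Measurable ψ) (hψs : ∀ k, Measurable (ψs k))
    (hC : ∀ k x, |ψ x - ψs k x| ≤ C)
    (hlim : Tendsto (fun k => ∫ x, |ψ x - ψs k x| ∂μX) atTop (𝓝 0))
    (h : ∀ k, OscVanishes P Xs σ (ψs k)) : OscVanishes P Xs σ ψ := by
  have hsl : ∀ k, ∀ᵐ ω ∂P, Tendsto (fun n : ℕ => (∑ i : Fin n, |ψ (Xs i ω) - ψs k (Xs i ω)|) / n)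
      atTop (𝓝 (∫ x, |ψ x - ψs k x| ∂μX)) := fun k =>
    tendsto_sample_mean hm hind hlaw (h := fun x => |ψ x - ψs k x|)
      ((hψ.sub (hψs k)).abs) (C := C) (fun x => by rw [abs_abs]; exact hC k x)
  filter_upwards [ae_all_iff.2 hsl, ae_all_iff.2 h] with ω h1 h2
  rw [Metric.tendsto_atTop]
  intro ε hε
  obtain ⟨k, hk⟩ := (hlim.eventually (gt_mem_nhds (show (0 : ℝ) < ε / 4 by positivity))).exists
  have e1 := (h1 k).eventually (gt_mem_nhds hk)
  have e2 := (h2 k).eventually (gt_mem_nhds (show (0 : ℝ) < ε / 4 by positivity))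
  obtain ⟨N, hN⟩ := eventually_atTop.1 (e1.and e2)
  refine ⟨N, fun n hn => ?_⟩
  obtain ⟨g1, g2⟩ := hN n hn
  have hnn : 0 ≤ adjSum (fun i j : Fin n =>
      |ψ (Xs (σ n ω j) ω) - ψ (Xs (σ n ω i) ω)|) / n :=
    div_nonneg (adjSum_nonneg fun _ _ => abs_nonneg _) n.cast_nonneg
  rw [Real.dist_eq, sub_zero, abs_of_nonneg hnn]
  set r : Fin n → ℝ := fun i => |ψ (Xs (σ n ω i) ω) - ψs k (Xs (σ n ω i) ω)| with hr
  have hrs : ∑ i, r i = ∑ i : Fin n, |ψ (Xs i ω) - ψs k (Xs i ω)| :=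
    Equiv.sum_comp (σ n ω) fun i : Fin n => |ψ (Xs i ω) - ψs k (Xs i ω)|
  have hr0 : ∀ i, 0 ≤ r i := fun i => abs_nonneg _
  have hle : adjSum (fun i j : Fin n => |ψ (Xs (σ n ω j) ω) - ψ (Xs (σ n ω i) ω)|) ≤
      adjSum (fun i j : Fin n => |ψs k (Xs (σ n ω j) ω) - ψs k (Xs (σ n ω i) ω)|)
        + ((∑ i, r i) + ∑ i, r i) := by
    refine le_trans ?_ (add_le_add_right (add_le_add (adjSum_right_le hr0) (adjSum_left_le hr0)) _)
    rw [← adjSum_add, ← adjSum_add]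
    refine adjSum_le fun i j => ?_
    have : ψ (Xs (σ n ω j) ω) - ψ (Xs (σ n ω i) ω)
      = (ψs k (Xs (σ n ω j) ω) - ψs k (Xs (σ n ω i) ω))
        + ((ψ (Xs (σ n ω j) ω) - ψs k (Xs (σ n ω j) ω))
          - (ψ (Xs (σ n ω i) ω) - ψs k (Xs (σ n ω i) ω))) := by ring
    rw [this]
    exact (abs_add_le _ _).trans (add_le_add_right (abs_sub _ _) _)
  -- Reordering does not change the total error of the approximation.
  rw [hrs] at hle
  calc _ ≤ (adjSum (fun i j : Fin n => |ψs k (Xs (σ n ω j) ω) - ψs k (Xs (σ n ω i) ω)|)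
        + ((∑ i : Fin n, |ψ (Xs i ω) - ψs k (Xs i ω)|)
          + ∑ i : Fin n, |ψ (Xs i ω) - ψs k (Xs i ω)|)) / n :=
        div_le_div_of_nonneg_right hle n.cast_nonneg
    _ < ε := by rw [add_div, add_div]; linarith

/-- The average oscillation of the indicator of a Borel set along the order statistics vanishes.
For half-lines the total oscillation is at most one, and the Borel sets with this property form
a `λ`-system. -/
lemma oscVanishes_indicator [IsProbabilityMeasure P] {μX : Measure ℝ} [IsProbabilityMeasure μX]
    (hm : ∀ i, Measurable (Xs i)) (hind : iIndepFun Xs P) (hlaw : ∀ i, P.map (Xs i) = μX)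
    (hσ : ∀ᵐ ω ∂P, ∀ n, IsIncreasingRearrangement (fun i : Fin n => Xs i ω) (σ n ω))
    {B : Set ℝ} (hB : MeasurableSet B) :
    OscVanishes P Xs σ (B.indicator fun _ => 1) := by
  classical
  have hgen : (inferInstance : MeasurableSpace ℝ)
      = MeasurableSpace.generateFrom (Set.range Set.Iic) := by
    rw [← borel_eq_generateFrom_Iic]; exact BorelSpace.measurable_eq
  induction B, hB using MeasurableSpace.induction_on_inter hgen isPiSystem_Iic with
  | empty => simpa using oscVanishes_const 0
  | basic t ht =>
    obtain ⟨a, rfl⟩ := ht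
    filter_upwards [hσ] with ω hω
    refine squeeze_zero (fun n => ?_) (fun n => ?_) tendsto_one_div_atTop_nhds_zero_nat
    · exact div_nonneg (adjSum_nonneg fun _ _ => abs_nonneg _) n.cast_nonneg
    · exact div_le_div_of_nonneg_right
        (adjSum_abs_indicator_Iic_le (x := fun i => Xs (σ n ω i) ω) (hω n) a) n.cast_nonneg
  | compl t htm ih =>
    have : tᶜ.indicator (fun _ => (1 : ℝ))
        = fun x => 1 + -1 * t.indicator (fun _ => (1 : ℝ)) x := by
      ext x
      by_cases hx : x ∈ t <;> simp [hx]
    rw [this]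
    exact (oscVanishes_const 1).add (ih.const_mul _)
  | iUnion f hd hf ih =>
    have hmi : ∀ s : Set ℝ, MeasurableSet s → Measurable (s.indicator fun _ => (1 : ℝ)) :=
      fun s hs => measurable_const.indicator hs
    have hUm : ∀ K, MeasurableSet (⋃ k ∈ Finset.range K, f k) := fun K =>
      Finset.measurableSet_biUnion _ fun k _ => hf k
    -- The finite unions approximate the countable union in `L¹` by dominated convergence.
    refine OscVanishes.of_approx (μX := μX) hm hind hlaw (C := 1)
      (ψs := fun K => (⋃ k ∈ Finset.range K, f k).indicator fun _ => 1)
      (hmi _ (MeasurableSet.iUnion hf)) (fun K => hmi _ (hUm K)) ?_ ?_ ?_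
    · intro K x
      simp only [Set.indicator_apply]
      split_ifs <;> simp
    · have hpt : ∀ x, Tendsto (fun K => |(⋃ k, f k).indicator (fun _ => (1 : ℝ)) x
          - (⋃ k ∈ Finset.range K, f k).indicator (fun _ => (1 : ℝ)) x|) atTop (𝓝 0) := by
        intro x
        refine tendsto_const_nhds.congr' ?_
        by_cases hx : x ∈ ⋃ k, f k
        · obtain ⟨k, hk⟩ := Set.mem_iUnion.1 hx
          filter_upwards [eventually_gt_atTop k] with K hK
          have hx' : x ∈ ⋃ k ∈ Finset.range K, f k :=
            Set.mem_biUnion (show k ∈ (Finset.range K : Set ℕ) by simpa using hK) hk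
          simp only [Set.indicator_of_mem hx, Set.indicator_of_mem hx', sub_self, abs_zero]
        · refine Eventually.of_forall fun K => ?_
          have hx' : x ∉ ⋃ k ∈ Finset.range K, f k := fun h =>
            hx (Set.iUnion₂_subset_iUnion _ _ h)
          simp only [Set.indicator_of_notMem hx, Set.indicator_of_notMem hx', sub_self, abs_zero]
      have := tendsto_integral_of_dominated_convergence (μ := μX)
        (F := fun K x => |(⋃ k, f k).indicator (fun _ => (1 : ℝ)) x
          - (⋃ k ∈ Finset.range K, f k).indicator (fun _ => (1 : ℝ)) x|)
        (f := fun _ => 0) (fun _ => (1 : ℝ))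
        (fun K => ((hmi _ (MeasurableSet.iUnion hf)).sub (hmi _ (hUm K))).abs.aestronglyMeasurable)
        (integrable_const _) (fun K => ae_of_all _ fun x => by
          simp only [Set.indicator_apply]
          split_ifs <;> simp) (ae_of_all _ hpt)
      simpa using this
    · intro K
      induction K with
      | zero => simpa using oscVanishes_const 0
      | succ K ihK =>
        have hdisj : Disjoint (⋃ k ∈ Finset.range K, f k) (f K) := by
          rw [Set.disjoint_iUnion₂_left]
          intro k hk
          exact hd (by simp at hk; omega)
        have : (⋃ k ∈ Finset.range (K + 1), f k).indicator (fun _ => (1 : ℝ)) =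
            fun x => (⋃ k ∈ Finset.range K, f k).indicator (fun _ => (1 : ℝ)) x
              + (f K).indicator (fun _ => (1 : ℝ)) x := by
          rw [Finset.range_add_one, Finset.set_biUnion_insert, Set.union_comm,
            Set.indicator_union_of_disjoint hdisj]
        rw [this]
        exact ihK.add (ih K)

/-- The average oscillation of a bounded Borel function along the order statistics vanishes. -/
lemma oscVanishes_of_bounded [IsProbabilityMeasure P] {μX : Measure ℝ} [IsProbabilityMeasure μX]
    (hm : ∀ i, Measurable (Xs i)) (hind : iIndepFun Xs P) (hlaw : ∀ i, P.map (Xs i) = μX)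
    (hσ : ∀ᵐ ω ∂P, ∀ n, IsIncreasingRearrangement (fun i : Fin n => Xs i ω) (σ n ω))
    (hψ : Measurable ψ) {C : ℝ} (hC : ∀ x, |ψ x| ≤ C) : OscVanishes P Xs σ ψ := by
  classical
  have hsimple : ∀ g : SimpleFunc ℝ ℝ, OscVanishes P Xs σ g := by
    intro g
    induction g using SimpleFunc.induction with
    | @const c s hs =>
      have := (oscVanishes_indicator hm hind hlaw hσ hs).const_mul c
      convert this using 2 with x
      by_cases hx : x ∈ s <;> simp [hx]
    | add _ h1 h2 => exact h1.add h2
  have hC0 : 0 ≤ C := (abs_nonneg _).trans (hC 0)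
  have hsm := hψ.stronglyMeasurable
  have hb : ∀ k x, |ψ x - hsm.approxBounded C k x| ≤ C + C := fun k x =>
    (abs_sub _ _).trans (add_le_add (hC x) (by
      simpa using hsm.norm_approxBounded_le hC0 k x))
  refine OscVanishes.of_approx (μX := μX) hm hind hlaw (C := C + C)
    (ψs := fun k => hsm.approxBounded C k) hψ (fun k => (hsm.approxBounded C k).measurable) hb ?_
    fun k => hsimple _
  have hpt : ∀ x, Tendsto (fun k => |ψ x - hsm.approxBounded C k x|) atTop (𝓝 0) := by
    intro x
    have := ((hsm.tendsto_approxBounded_of_norm_le (by simpa using hC x)).const_sub (ψ x)).abs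
    simpa using this
  have := tendsto_integral_of_dominated_convergence (μ := μX) (fun _ => C + C)
    (fun k => (hψ.sub (hsm.approxBounded C k).measurable).abs.aestronglyMeasurable)
    (integrable_const _) (fun k => ae_of_all _ fun x => by
      rw [Real.norm_eq_abs, abs_abs]; exact hb k x) (ae_of_all _ hpt)
  simpa using this

end Oscillation

/-! ### The mean contribution of a pair of neighbours -/

/-- For a family `q t x` of conditional probabilities of `Y ≥ t` given `X = x`, this is the average
over `t` of the probability that exactly one of two independent draws, one given `X = x` and the
other given `X = x'`, is at least `t`. -/
noncomputable def pairMean (μ : Measure ℝ) (q : ℝ → ℝ → ℝ) (x x' : ℝ) : ℝ :=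
  ∫ t, (q t x + q t x' - 2 * (q t x * q t x')) ∂μ

lemma integrable_add_sub_two_mul {α : Type*} [MeasurableSpace α] {μ : Measure α} {f g h : α → ℝ}
    (hf : Integrable f μ) (hg : Integrable g μ) (hh : Integrable h μ) :
    Integrable (fun x => f x + g x - 2 * h x) μ :=
  (hf.add hg).sub (hh.const_mul 2)

lemma integral_add_sub_two_mul {α : Type*} [MeasurableSpace α] {μ : Measure α} {f g h : α → ℝ}
    (hf : Integrable f μ) (hg : Integrable g μ) (hh : Integrable h μ) :
    ∫ x, (f x + g x - 2 * h x) ∂μ = ∫ x, f x ∂μ + ∫ x, g x ∂μ - 2 * ∫ x, h x ∂μ := by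
  rw [← integral_const_mul, ← integral_add hf hg]
  exact integral_sub (hf.add hg) (hh.const_mul 2)

lemma indicator_Ici_mem_Icc (t a : ℝ) :
    (Set.Ici t).indicator (fun _ => (1 : ℝ)) a ∈ Set.Icc (0 : ℝ) 1 := by
  simp only [Set.indicator_apply]
  split_ifs <;> simp

lemma measurable_indicator_Ici :
    Measurable fun z : ℝ × ℝ => (Set.Ici z.1).indicator (fun _ => (1 : ℝ)) z.2 := by
  have : (fun z : ℝ × ℝ => (Set.Ici z.1).indicator (fun _ => (1 : ℝ)) z.2)
      = {z : ℝ × ℝ | z.1 ≤ z.2}.indicator fun _ => 1 := by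
    ext z
    simp [Set.indicator_apply]
  rw [this]
  exact measurable_const.indicator (measurableSet_le measurable_fst measurable_snd)

lemma integral_indicator_Ici (α : Measure ℝ) (t : ℝ) :
    ∫ a, (Set.Ici t).indicator (fun _ => (1 : ℝ)) a ∂α = α.real (Set.Ici t) := by
  rw [integral_indicator measurableSet_Ici]
  simp

lemma abs_cdf_sub_eq (μ : Measure ℝ) [IsProbabilityMeasure μ] (a b : ℝ) :
    |μ.real (Set.Iic b) - μ.real (Set.Iic a)| =
      ∫ t, ((Set.Ici t).indicator (fun _ => (1 : ℝ)) a + (Set.Ici t).indicator (fun _ => (1 : ℝ)) b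
        - 2 * ((Set.Ici t).indicator (fun _ => (1 : ℝ)) a
          * (Set.Ici t).indicator (fun _ => (1 : ℝ)) b)) ∂μ := by
  have hind : ∀ c : ℝ, (fun t => (Set.Ici t).indicator (fun _ => (1 : ℝ)) c)
      = (Set.Iic c).indicator fun _ => 1 := by
    intro c; ext t; simp [Set.indicator_apply]
  have hmul : (fun t => (Set.Ici t).indicator (fun _ => (1 : ℝ)) a
      * (Set.Ici t).indicator (fun _ => (1 : ℝ)) b) = (Set.Iic (min a b)).indicator fun _ => 1 := by
    ext t
    simp only [Set.indicator_apply, Set.mem_Ici, Set.mem_Iic, le_min_iff]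
    split_ifs <;> simp_all
  have hint : ∀ c : ℝ, Integrable ((Set.Iic c).indicator fun _ => (1 : ℝ)) μ := fun c =>
    (integrable_const _).indicator measurableSet_Iic
  have hval : ∀ c : ℝ, ∫ t, (Set.Iic c).indicator (fun _ => (1 : ℝ)) t ∂μ = μ.real (Set.Iic c) :=
    fun c => by rw [integral_indicator measurableSet_Iic]; simp
  have ha := hint a
  have hb := hint b
  have hm := hint (min a b)
  have va := hval a
  have vb := hval b
  have vm := hval (min a b)
  rw [← hind] at ha hb va vb
  rw [← hmul] at hm vm
  rw [integral_add_sub_two_mul ha hb hm]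
  rw [va, vb, vm]
  rcases le_total a b with h | h
  · rw [min_eq_left h, abs_of_nonneg (sub_nonneg.2 (measureReal_mono (Set.Iic_subset_Iic.2 h)))]
    ring
  · rw [min_eq_right h, abs_of_nonpos (sub_nonpos.2 (measureReal_mono (Set.Iic_subset_Iic.2 h)))]
    ring

/-- The mean distance of the `μ`-distribution function at two independent points. -/
lemma integral_abs_cdf_sub (α β μ : Measure ℝ) [IsProbabilityMeasure α] [IsProbabilityMeasure β]
    [IsProbabilityMeasure μ] :
    ∫ z, |μ.real (Set.Iic z.2) - μ.real (Set.Iic z.1)| ∂(α.prod β) =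
      ∫ t, (α.real (Set.Ici t) + β.real (Set.Ici t)
        - 2 * (α.real (Set.Ici t) * β.real (Set.Ici t))) ∂μ := by
  simp_rw [abs_cdf_sub_eq]
  have m1 : Measurable fun w : (ℝ × ℝ) × ℝ => (Set.Ici w.2).indicator (fun _ => (1 : ℝ)) w.1.1 :=
    measurable_indicator_Ici.comp (measurable_snd.prodMk measurable_fst.fst)
  have m2 : Measurable fun w : (ℝ × ℝ) × ℝ => (Set.Ici w.2).indicator (fun _ => (1 : ℝ)) w.1.2 :=
    measurable_indicator_Ici.comp (measurable_snd.prodMk measurable_fst.snd)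
  have bound : ∀ x ∈ Set.Icc (0 : ℝ) 1, ∀ y ∈ Set.Icc (0 : ℝ) 1, |x + y - 2 * (x * y)| ≤ 1 := by
    rintro x ⟨hx0, hx1⟩ y ⟨hy0, hy1⟩
    rw [abs_le]
    constructor <;> nlinarith
  rw [integral_integral_swap]
  · refine integral_congr_ae (ae_of_all _ fun t => ?_)
    have hi : ∀ (γ : Measure ℝ) [IsProbabilityMeasure γ],
        Integrable (fun a => (Set.Ici t).indicator (fun _ => (1 : ℝ)) a) γ := fun γ _ =>
      (integrable_const _).indicator measurableSet_Ici
    have i1 : Integrable (fun z : ℝ × ℝ => (Set.Ici t).indicator (fun _ => (1 : ℝ)) z.1)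
      (α.prod β) := (hi α).comp_fst β
    have i2 : Integrable (fun z : ℝ × ℝ => (Set.Ici t).indicator (fun _ => (1 : ℝ)) z.2)
      (α.prod β) := (hi β).comp_snd α
    have i3 : Integrable (fun z : ℝ × ℝ => (Set.Ici t).indicator (fun _ => (1 : ℝ)) z.1
        * (Set.Ici t).indicator (fun _ => (1 : ℝ)) z.2) (α.prod β) := (hi α).mul_prod (hi β)
    simp only
    rw [integral_add_sub_two_mul i1 i2 i3,
      integral_prod_mul (fun a => (Set.Ici t).indicator (fun _ => (1 : ℝ)) a)
        (fun a => (Set.Ici t).indicator (fun _ => (1 : ℝ)) a),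
      integral_fun_fst (fun a => (Set.Ici t).indicator (fun _ => (1 : ℝ)) a),
      integral_fun_snd (fun a => (Set.Ici t).indicator (fun _ => (1 : ℝ)) a)]
    simp only [integral_indicator_Ici, probReal_univ, one_smul]
  · refine Integrable.of_bound (C := 1) ?_ (ae_of_all _ fun w => ?_)
    · exact ((m1.add m2).sub ((m1.mul m2).const_mul 2)).aestronglyMeasurable
    · exact bound _ (indicator_Ici_mem_Icc _ _) _ (indicator_Ici_mem_Icc _ _)

section PairMean

variable {μ : Measure ℝ} [IsProbabilityMeasure μ] {q : ℝ → ℝ → ℝ}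

lemma measurable_pairMean (hq : Measurable (Function.uncurry q)) :
    Measurable (Function.uncurry (pairMean μ q)) := by
  have h1 : Measurable fun w : (ℝ × ℝ) × ℝ => q w.2 w.1.1 :=
    hq.comp (measurable_snd.prodMk measurable_fst.fst)
  have h2 : Measurable fun w : (ℝ × ℝ) × ℝ => q w.2 w.1.2 :=
    hq.comp (measurable_snd.prodMk measurable_fst.snd)
  have h := ((h1.add h2).sub ((h1.mul h2).const_mul 2)).stronglyMeasurable
  exact h.integral_prod_right.measurable

lemma integrable_section (hq : Measurable (Function.uncurry q))
    (hq01 : ∀ t x, q t x ∈ Set.Icc (0 : ℝ) 1) (x : ℝ) : Integrable (fun t => q t x) μ :=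
  Integrable.of_mem_Icc 0 1 (hq.comp measurable_prodMk_right).aemeasurable
    (ae_of_all _ fun t => hq01 t x)

lemma integrable_section_mul (hq : Measurable (Function.uncurry q))
    (hq01 : ∀ t x, q t x ∈ Set.Icc (0 : ℝ) 1) (x x' : ℝ) :
    Integrable (fun t => q t x * q t x') μ :=
  Integrable.of_mem_Icc 0 1
    ((hq.comp measurable_prodMk_right).mul (hq.comp measurable_prodMk_right)).aemeasurable
    (ae_of_all _ fun t => ⟨mul_nonneg (hq01 t x).1 (hq01 t x').1,
      mul_le_one₀ (hq01 t x).2 (hq01 t x').1 (hq01 t x').2⟩)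

lemma pairMean_mem_Icc (hq01 : ∀ t x, q t x ∈ Set.Icc (0 : ℝ) 1) (x x' : ℝ) :
    pairMean μ q x x' ∈ Set.Icc (0 : ℝ) 1 := by
  have hb : ∀ t, q t x + q t x' - 2 * (q t x * q t x') ∈ Set.Icc (0 : ℝ) 1 := by
    intro t
    obtain ⟨h1, h2⟩ := hq01 t x
    obtain ⟨h3, h4⟩ := hq01 t x'
    constructor <;> nlinarith
  refine ⟨integral_nonneg fun t => (hb t).1, ?_⟩
  have := norm_integral_le_of_norm_le_const (μ := μ) (ae_of_all _ fun t => show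
    ‖q t x + q t x' - 2 * (q t x * q t x')‖ ≤ 1 by
      rw [Real.norm_eq_abs, abs_of_nonneg (hb t).1]; exact (hb t).2)
  simp only [probReal_univ, mul_one] at this
  exact (le_abs_self _).trans this

lemma abs_pairMean_sub_le (hq : Measurable (Function.uncurry q))
    (hq01 : ∀ t x, q t x ∈ Set.Icc (0 : ℝ) 1) (x x' : ℝ) :
    |pairMean μ q x x' - pairMean μ q x x| ≤ ∫ t, |q t x' - q t x| ∂μ := by
  have i1 := integrable_section (μ := μ) hq hq01
  have i2 := integrable_section_mul (μ := μ) hq hq01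
  unfold pairMean
  rw [← integral_sub (integrable_add_sub_two_mul (i1 x) (i1 x') (i2 x x'))
    (integrable_add_sub_two_mul (i1 x) (i1 x) (i2 x x))]
  refine (abs_integral_le_integral_abs).trans (integral_mono_of_nonneg
    (ae_of_all _ fun t => abs_nonneg _) ((i1 x').sub (i1 x)).abs (ae_of_all _ fun t => ?_))
  have : q t x + q t x' - 2 * (q t x * q t x') - (q t x + q t x - 2 * (q t x * q t x))
      = (1 - 2 * q t x) * (q t x' - q t x) := by ring
  simp only [this, abs_mul]
  refine mul_le_of_le_one_left (abs_nonneg _) ?_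
  obtain ⟨h1, h2⟩ := hq01 t x
  rw [abs_le]
  constructor <;> linarith

variable {Ω : Type*} [MeasurableSpace Ω] {P : Measure Ω} [IsProbabilityMeasure P]
  {Xs : ℕ → Ω → ℝ} {σ : (n : ℕ) → Ω → Equiv.Perm (Fin n)}

omit [IsProbabilityMeasure P] in
lemma measurable_comp_perm (hm : ∀ i, Measurable (Xs i)) {n : ℕ}
    (hσm : ∀ p, MeasurableSet {ω | σ n ω = p}) (i : Fin n) :
    Measurable fun ω => Xs (σ n ω i) ω := by
  intro s hs
  have : (fun ω => Xs (σ n ω i) ω) ⁻¹' s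
      = ⋃ p : Equiv.Perm (Fin n), {ω | σ n ω = p} ∩ Xs (p i) ⁻¹' s := by
    ext ω
    simp
  rw [this]
  exact MeasurableSet.iUnion fun p => (hσm p).inter (hm _ hs)

/-- Along the order statistics, the average mean contribution of neighbouring pairs converges to
the mean contribution of a pair with equal `x`-values. -/
lemma tendsto_adjSum_pairMean {μX : Measure ℝ} [IsProbabilityMeasure μX]
    (hm : ∀ i, Measurable (Xs i)) (hind : iIndepFun Xs P) (hlaw : ∀ i, P.map (Xs i) = μX)
    (hσm : ∀ n p, MeasurableSet {ω | σ n ω = p})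
    (hσ : ∀ᵐ ω ∂P, ∀ n, IsIncreasingRearrangement (fun i : Fin n => Xs i ω) (σ n ω))
    (hq : Measurable (Function.uncurry q)) (hq01 : ∀ t x, q t x ∈ Set.Icc (0 : ℝ) 1) :
    ∀ᵐ ω ∂P, Tendsto (fun n : ℕ => adjSum (fun i j : Fin n =>
      pairMean μ q (Xs (σ n ω i) ω) (Xs (σ n ω j) ω)) / n) atTop
        (𝓝 (∫ x, pairMean μ q x x ∂μX)) := by
  have hosc : ∀ t, OscVanishes P Xs σ (q t) := fun t =>
    oscVanishes_of_bounded hm hind hlaw hσ (hq.comp measurable_prodMk_left) (C := 1) fun x => by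
      rw [abs_of_nonneg (hq01 t x).1]; exact (hq01 t x).2
  set D : ℕ → Ω × ℝ → ℝ := fun n w => adjSum (fun i j : Fin n =>
    |q w.2 (Xs (σ n w.1 j) w.1) - q w.2 (Xs (σ n w.1 i) w.1)|) / n with hD
  have hterm : ∀ n (i : Fin n), Measurable fun w : Ω × ℝ => q w.2 (Xs (σ n w.1 i) w.1) :=
    fun n i => hq.comp (measurable_snd.prodMk
      ((measurable_comp_perm hm (hσm n) i).comp measurable_fst))
  have hDm : ∀ n, Measurable (D n) := by
    intro n
    refine Measurable.div_const (Finset.measurable_sum _ fun i _ => ?_) _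
    split_ifs
    · exact ((hterm n _).sub (hterm n _)).abs
    · exact measurable_const
  -- For each `t` the oscillation vanishes almost surely, hence almost surely for almost every `t`.
  have hswap : ∀ᵐ ω ∂P, ∀ᵐ t ∂μ, Tendsto (fun n => D n (ω, t)) atTop (𝓝 0) := by
    rw [Measure.ae_ae_comm (p := fun ω t => Tendsto (fun n => D n (ω, t)) atTop (𝓝 0))
      (measurableSet_tendsto _ hDm)]
    exact ae_of_all _ hosc
  have hpm : Measurable fun x => pairMean μ q x x :=
    (measurable_pairMean hq).comp (measurable_id.prodMk measurable_id)
  have hslln := tendsto_sample_mean hm hind hlaw (h := fun x => pairMean μ q x x) hpm (C := 1)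
    fun x => by
      have := pairMean_mem_Icc (μ := μ) hq01 x x
      rw [abs_of_nonneg this.1]; exact this.2
  filter_upwards [hswap, hslln] with ω h1 h2
  have hD0 : ∀ n t, 0 ≤ D n (ω, t) := fun n t =>
    div_nonneg (adjSum_nonneg fun _ _ => abs_nonneg _) n.cast_nonneg
  have hD1 : ∀ n t, D n (ω, t) ≤ 1 := by
    intro n t
    refine div_le_one_of_le₀ ?_ n.cast_nonneg
    refine (adjSum_le (g := fun _ _ => 1) fun i j => ?_).trans
      ((adjSum_const_le zero_le_one).trans_eq (mul_one _))
    have ha := hq01 t (Xs (σ n ω i) ω)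
    have hb := hq01 t (Xs (σ n ω j) ω)
    rw [abs_le]
    constructor <;> linarith [ha.1, ha.2, hb.1, hb.2]
  have hI : Tendsto (fun n => ∫ t, D n (ω, t) ∂μ) atTop (𝓝 0) := by
    have := tendsto_integral_of_dominated_convergence (μ := μ) (F := fun n t => D n (ω, t))
      (f := fun _ => 0) (fun _ => 1)
      (fun n => ((hDm n).comp measurable_prodMk_left).aestronglyMeasurable) (integrable_const _)
      (fun n => ae_of_all _ fun t => by
        rw [Real.norm_eq_abs, abs_of_nonneg (hD0 n t)]; exact hD1 n t) h1
    simpa using this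
  -- Replacing `X_(i+1)` by `X_(i)` costs the mean oscillation, and one index has no successor.
  have herr : ∀ n : ℕ, |adjSum (fun i j : Fin n =>
      pairMean μ q (Xs (σ n ω i) ω) (Xs (σ n ω j) ω)) / n
        - (∑ i : Fin n, pairMean μ q (Xs i ω) (Xs i ω)) / n| ≤ ∫ t, D n (ω, t) ∂μ + 1 / n := by
    intro n
    have hDint : ∫ t, D n (ω, t) ∂μ = adjSum (fun i j : Fin n =>
        ∫ t, |q t (Xs (σ n ω j) ω) - q t (Xs (σ n ω i) ω)| ∂μ) / n := by
      simp only [hD]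
      rw [integral_div]
      congr 1
      unfold adjSum
      have i1 := integrable_section (μ := μ) hq hq01
      rw [integral_finsetSum]
      · refine Finset.sum_congr rfl fun i _ => ?_
        split_ifs <;> simp
      · intro i _
        split_ifs
        · exact ((i1 _).sub (i1 _)).abs
        · exact integrable_zero _ _ _
    have e1 : |adjSum (fun i j : Fin n => pairMean μ q (Xs (σ n ω i) ω) (Xs (σ n ω j) ω))
        - adjSum (fun i _ : Fin n => pairMean μ q (Xs (σ n ω i) ω) (Xs (σ n ω i) ω))|
        ≤ adjSum (fun i j : Fin n =>
          ∫ t, |q t (Xs (σ n ω j) ω) - q t (Xs (σ n ω i) ω)| ∂μ) := by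
      rw [← adjSum_sub]
      exact (abs_adjSum_le _).trans (adjSum_le fun i j => abs_pairMean_sub_le hq hq01 _ _)
    have hperm : ∑ i : Fin n, pairMean μ q (Xs (σ n ω i) ω) (Xs (σ n ω i) ω)
        = ∑ i : Fin n, pairMean μ q (Xs i ω) (Xs i ω) :=
      Equiv.sum_comp (σ n ω) fun i : Fin n => pairMean μ q (Xs i ω) (Xs i ω)
    have e2 := adjSum_left_le
      (g := fun i : Fin n => pairMean μ q (Xs (σ n ω i) ω) (Xs (σ n ω i) ω))
      fun i => (pairMean_mem_Icc hq01 _ _).1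
    have e3 := adjSum_left_ge
      (g := fun i : Fin n => pairMean μ q (Xs (σ n ω i) ω) (Xs (σ n ω i) ω)) zero_le_one
      fun i => (pairMean_mem_Icc hq01 _ _).2
    rw [hperm] at e2 e3
    rw [hDint, ← sub_div, ← add_div, abs_div, Nat.abs_cast]
    refine div_le_div_of_nonneg_right ?_ n.cast_nonneg
    rw [abs_le] at e1 ⊢
    constructor <;> linarith [e1.1, e1.2]
  have hzero : Tendsto (fun n : ℕ => ∫ t, D n (ω, t) ∂μ + 1 / (n : ℝ)) atTop (𝓝 0) := by
    simpa using hI.add tendsto_one_div_atTop_nhds_zero_nat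
  have hdiff := squeeze_zero_norm (fun n => (Real.norm_eq_abs _).trans_le (herr n)) hzero
  simpa using hdiff.add h2

end PairMean

/-! ### Conditioning on the `x`-values and on the rearrangement -/

lemma adjSum_congr {n : ℕ} {f g : Fin n → Fin n → ℝ}
    (h : ∀ i j : Fin n, (j : ℕ) = i + 1 → f i j = g i j) : adjSum f = adjSum g := by
  refine Finset.sum_congr rfl fun i _ => ?_
  split_ifs
  · exact h _ _ rfl
  · rfl

open Classical in
/-- The conditional probability that a uniformly random increasing rearrangement of `x` is `p`. -/
noncomputable def uniformWeight {n : ℕ} (x : Fin n → ℝ) (p : Equiv.Perm (Fin n)) : ℝ :=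
  if IsIncreasingRearrangement x p then
    1 / (Set.ncard {q | IsIncreasingRearrangement x q} : ℝ) else 0

lemma uniformWeight_nonneg {n : ℕ} (x : Fin n → ℝ) (p : Equiv.Perm (Fin n)) :
    0 ≤ uniformWeight x p := by
  unfold uniformWeight
  split_ifs <;> positivity

lemma sum_uniformWeight_le {n : ℕ} (x : Fin n → ℝ) : ∑ p, uniformWeight x p ≤ 1 := by
  classical
  unfold uniformWeight
  rw [← Finset.sum_filter, Finset.sum_const, nsmul_eq_mul, Set.ncard_eq_toFinset_card']
  simp only [Set.toFinset_ofPred, mul_one_div]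
  exact div_self_le_one _

lemma measurableSet_isIncreasingRearrangement {n : ℕ} (p : Equiv.Perm (Fin n)) :
    MeasurableSet {x : Fin n → ℝ | IsIncreasingRearrangement x p} := by
  have : {x : Fin n → ℝ | IsIncreasingRearrangement x p}
      = ⋂ (i : Fin n) (j : Fin n) (_ : i ≤ j), {x | x (p i) ≤ x (p j)} := by
    ext x
    simp only [Set.mem_ofPred_eq, Set.mem_iInter]
    exact Iff.rfl
  rw [this]
  exact MeasurableSet.iInter fun i => MeasurableSet.iInter fun j => MeasurableSet.iInter fun _ =>
    measurableSet_le (measurable_pi_apply _) (measurable_pi_apply _)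

lemma measurable_uniformWeight {n : ℕ} (p : Equiv.Perm (Fin n)) :
    Measurable fun x : Fin n → ℝ => uniformWeight x p := by
  classical
  unfold uniformWeight
  refine Measurable.ite (measurableSet_isIncreasingRearrangement p) ?_ measurable_const
  refine Measurable.const_div ?_ _
  have : (fun x : Fin n → ℝ => (Set.ncard {q | IsIncreasingRearrangement x q} : ℝ))
      = fun x => ∑ q : Equiv.Perm (Fin n),
        if IsIncreasingRearrangement x q then (1 : ℝ) else 0 := by
    ext x
    rw [Finset.sum_boole, Set.ncard_eq_toFinset_card', Set.toFinset_ofPred]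
  rw [this]
  exact Finset.measurable_sum _ fun q _ =>
    Measurable.ite (measurableSet_isIncreasingRearrangement q) measurable_const measurable_const

section Transfer

variable {Ω : Type*} [MeasurableSpace Ω] {P : Measure Ω} [IsProbabilityMeasure P]

/-- The defining property of a uniform rearrangement, as a formula for the joint law of the sample
and the rearrangement. -/
lemma measure_perm_inter {n : ℕ} {x y : Ω → Fin n → ℝ} {σ : Ω → Equiv.Perm (Fin n)}
    (hx : Measurable x) (hy : Measurable y) (hσ : IsUniformRearrangement P x y σ)
    (p : Equiv.Perm (Fin n)) {S : Set ((Fin n → ℝ) × (Fin n → ℝ))} (hS : MeasurableSet S) :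
    P ({ω | σ ω = p} ∩ (fun ω => (x ω, y ω)) ⁻¹' S)
      = ∫⁻ z in S, ENNReal.ofReal (uniformWeight z.1 p) ∂(P.map fun ω => (x ω, y ω)) := by
  have hxy : Measurable fun ω => (x ω, y ω) := hx.prodMk hy
  have hw : Measurable fun z : (Fin n → ℝ) × (Fin n → ℝ) => uniformWeight z.1 p :=
    (measurable_uniformWeight p).comp measurable_fst
  have h1 := setIntegral_condExp (μ := P) hxy.comap_le
    (f := Set.indicator {ω | σ ω = p} fun _ => (1 : ℝ))
    ((integrable_const _).indicator (hσ.measurableSet_eq p)) (s := (fun ω => (x ω, y ω)) ⁻¹' S)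
    ⟨S, hS, rfl⟩
  rw [setIntegral_congr_ae (g := fun ω => uniformWeight (x ω) p) (hxy hS)
    ((hσ.condProb_eq p).mono fun ω h _ => h), integral_indicator (hσ.measurableSet_eq p),
    Measure.restrict_restrict (hσ.measurableSet_eq p), setIntegral_const, smul_eq_mul,
    mul_one] at h1
  have hle : ∀ x, uniformWeight x p ≤ 1 := fun x =>
    (Finset.single_le_sum (fun q _ => uniformWeight_nonneg x q) (Finset.mem_univ p)).trans
      (sum_uniformWeight_le x)
  have hint : Integrable (fun ω => uniformWeight (x ω) p)
      (P.restrict ((fun ω => (x ω, y ω)) ⁻¹' S)) :=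
    Integrable.of_mem_Icc 0 1 ((measurable_uniformWeight p).comp hx).aemeasurable
      (ae_of_all _ fun ω => ⟨uniformWeight_nonneg _ _, hle _⟩)
  rw [setLIntegral_map hS hw.ennreal_ofReal hxy, ← ofReal_integral_eq_lintegral_ofReal hint
    (ae_of_all _ fun ω => uniformWeight_nonneg _ _), h1, ofReal_measureReal]

lemma ae_isIncreasingRearrangement {n : ℕ} {x y : Ω → Fin n → ℝ} {σ : Ω → Equiv.Perm (Fin n)}
    (hx : Measurable x) (hy : Measurable y) (hσ : IsUniformRearrangement P x y σ) :
    ∀ᵐ ω ∂P, IsIncreasingRearrangement (x ω) (σ ω) := by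
  have h : ∀ p, ∀ᵐ ω ∂P, ¬ (ω ∈ {ω | σ ω = p} ∩ (fun ω => (x ω, y ω)) ⁻¹'
      {z | ¬ IsIncreasingRearrangement z.1 p}) := by
    intro p
    have hS : MeasurableSet {z : (Fin n → ℝ) × (Fin n → ℝ) | ¬ IsIncreasingRearrangement z.1 p} :=
      (measurable_fst (measurableSet_isIncreasingRearrangement p)).compl
    have := measure_perm_inter hx hy hσ p hS
    rw [setLIntegral_congr_fun (g := fun _ => 0) hS] at this
    · rw [lintegral_zero] at this
      exact measure_eq_zero_iff_ae_notMem.1 this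
    · intro z hz
      have hz' : ¬ IsIncreasingRearrangement z.1 p := hz
      simp [uniformWeight, hz']
  filter_upwards [ae_all_iff.2 h] with ω hω
  by_contra hcon
  exact hω (σ ω) ⟨rfl, hcon⟩

/-- If `Φ x` pushes the uniform law forward to `κ x`, then `(x, u) ↦ (x, Φ x u)` realizes the joint
law with first marginal `μX` and conditional law `κ`. -/
lemma map_prod_eq_compProd {μX : Measure ℝ} [IsProbabilityMeasure μX] {κ : Kernel ℝ ℝ}
    [IsMarkovKernel κ] {Φ : ℝ → unitInterval → ℝ} (hΦ : Measurable (Function.uncurry Φ))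
    (hκ : ∀ x, (volume : Measure unitInterval).map (Φ x) = κ x) :
    (μX.prod (volume : Measure unitInterval)).map (fun w => (w.1, Φ w.1 w.2)) = μX ⊗ₘ κ := by
  have hg : Measurable fun w : ℝ × unitInterval => (w.1, Φ w.1 w.2) := measurable_fst.prodMk hΦ
  ext s hs
  rw [Measure.map_apply hg hs, Measure.prod_apply (hg hs), Measure.compProd_apply hs]
  refine lintegral_congr fun x => ?_
  have hΦx : Measurable (Φ x) := hΦ.comp measurable_prodMk_left
  rw [← hκ x, Measure.map_apply hΦx (measurable_prodMk_left hs)]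
  rfl

omit [IsProbabilityMeasure P] in
/-- The joint law of the `x`-values and `y`-values of a sample: the `y`-values can be generated from
the `x`-values with the help of independent uniform variables. -/
lemma map_sample_eq {Xs Ys : ℕ → Ω → ℝ} (hX : ∀ i, Measurable (Xs i))
    (hY : ∀ i, Measurable (Ys i)) (hind : iIndepFun (fun i ω => (Xs i ω, Ys i ω)) P)
    {μX : Measure ℝ} [IsProbabilityMeasure μX] {Φ : ℝ → unitInterval → ℝ}
    (hΦ : Measurable (Function.uncurry Φ))
    (hlaw : ∀ i, P.map (fun ω => (Xs i ω, Ys i ω))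
      = (μX.prod (volume : Measure unitInterval)).map fun w => (w.1, Φ w.1 w.2)) (n : ℕ) :
    P.map (fun ω => ((fun i : Fin n => Xs i ω), (fun i : Fin n => Ys i ω)))
      = ((Measure.pi fun _ : Fin n => μX).prod
        (Measure.pi fun _ : Fin n => (volume : Measure unitInterval))).map
          fun w => (w.1, fun i => Φ (w.1 i) (w.2 i)) := by
  have hg : Measurable fun w : ℝ × unitInterval => (w.1, Φ w.1 w.2) := measurable_fst.prodMk hΦ
  have hG : Measurable fun w : (Fin n → ℝ) × (Fin n → unitInterval) =>
      (w.1, fun i => Φ (w.1 i) (w.2 i)) :=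
    measurable_fst.prodMk (measurable_pi_lambda _ fun i => hΦ.comp
      (f := fun w : (Fin n → ℝ) × (Fin n → unitInterval) => (w.1 i, w.2 i))
      (((measurable_pi_apply i).comp measurable_fst).prodMk
        ((measurable_pi_apply i).comp measurable_snd)))
  have hpair : ∀ i, Measurable fun ω => (Xs i ω, Ys i ω) := fun i => (hX i).prodMk (hY i)
  have h1 : P.map (fun ω (i : Fin n) => (Xs i ω, Ys i ω))
      = (Measure.pi fun _ : Fin n => μX.prod (volume : Measure unitInterval)).map
        fun z i => ((z i).1, Φ (z i).1 (z i).2) := by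
    have hind' : iIndepFun (fun (i : Fin n) ω => (Xs i ω, Ys i ω)) P :=
      hind.precomp Fin.val_injective
    rw [hind'.map_fun_eq_pi_map fun i : Fin n => (hpair i).aemeasurable]
    have hpr : IsProbabilityMeasure ((μX.prod (volume : Measure unitInterval)).map
      fun w => (w.1, Φ w.1 w.2)) := Measure.isProbabilityMeasure_map hg.aemeasurable
    rw [Measure.pi_map_pi (μ := fun _ : Fin n => μX.prod (volume : Measure unitInterval))
      (f := fun _ w => (w.1, Φ w.1 w.2)) fun _ => hg.aemeasurable]
    congr 1
    ext1 i
    exact hlaw i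
  have hpres := measurePreserving_arrowProdEquivProdArrow ℝ unitInterval (Fin n) (fun _ => μX)
    (fun _ => (volume : Measure unitInterval))
  have hgn : Measurable fun (z : Fin n → ℝ × unitInterval) (i : Fin n) =>
      ((z i).1, Φ (z i).1 (z i).2) :=
    measurable_pi_lambda _ fun i => hg.comp (measurable_pi_apply i)
  have h2 := congrArg (Measure.map (MeasurableEquiv.arrowProdEquivProdArrow ℝ ℝ (Fin n))) h1
  rw [Measure.map_map (MeasurableEquiv.measurable _)
      (measurable_pi_lambda _ fun i : Fin n => hpair i),
    Measure.map_map (MeasurableEquiv.measurable _) hgn] at h2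
  rw [← hpres.map_eq, Measure.map_map hG hpres.measurable]
  exact h2

/-- A bound that holds for fixed `x`-values and every fixed permutation passes to the random
rearrangement, which depends on the `y`-values only through the `x`-values. -/
lemma measure_perm_event_le {n : ℕ} {x y : Ω → Fin n → ℝ} {σ : Ω → Equiv.Perm (Fin n)}
    (hx : Measurable x) (hy : Measurable y) (hσ : IsUniformRearrangement P x y σ)
    {μn : Measure (Fin n → ℝ)} [IsProbabilityMeasure μn] {U : Type*} [MeasurableSpace U]
    {ρ : Measure U} [IsProbabilityMeasure ρ] {Ψ : (Fin n → ℝ) → U → (Fin n → ℝ)}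
    (hΨ : Measurable (Function.uncurry Ψ))
    (hlaw : P.map (fun ω => (x ω, y ω)) = (μn.prod ρ).map fun w => (w.1, Ψ w.1 w.2))
    {bad : Equiv.Perm (Fin n) → Set ((Fin n → ℝ) × (Fin n → ℝ))}
    (hbad : ∀ p, MeasurableSet (bad p)) {δ : ENNReal}
    (hδ : ∀ p x, ρ {u | (x, Ψ x u) ∈ bad p} ≤ δ) :
    P {ω | (x ω, y ω) ∈ bad (σ ω)} ≤ δ := by
  have hG : Measurable fun w : (Fin n → ℝ) × U => (w.1, Ψ w.1 w.2) := measurable_fst.prodMk hΨ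
  have hwm : ∀ p, Measurable fun x : Fin n → ℝ => ENNReal.ofReal (uniformWeight x p) := fun p =>
    (measurable_uniformWeight p).ennreal_ofReal
  have hind : ∀ p, Measurable ((bad p).indicator fun z : (Fin n → ℝ) × (Fin n → ℝ) =>
      ENNReal.ofReal (uniformWeight z.1 p)) := fun p =>
    ((hwm p).comp measurable_fst).indicator (hbad p)
  have hp : ∀ p, P ({ω | σ ω = p} ∩ (fun ω => (x ω, y ω)) ⁻¹' bad p)
      ≤ ∫⁻ x, δ * ENNReal.ofReal (uniformWeight x p) ∂μn := by
    intro p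
    have hcomp : Measurable fun w : (Fin n → ℝ) × U => (bad p).indicator
        (fun z => ENNReal.ofReal (uniformWeight z.1 p)) (w.1, Ψ w.1 w.2) := (hind p).comp hG
    rw [measure_perm_inter hx hy hσ p (hbad p), hlaw, ← lintegral_indicator (hbad p),
      lintegral_map (hind p) hG, lintegral_prod _ hcomp.aemeasurable]
    refine lintegral_mono fun x => ?_
    have hsec : MeasurableSet {u | (x, Ψ x u) ∈ bad p} :=
      (hG.comp measurable_prodMk_left) (hbad p)
    have : ∀ u, (bad p).indicator (fun z => ENNReal.ofReal (uniformWeight z.1 p)) (x, Ψ x u)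
        = {u | (x, Ψ x u) ∈ bad p}.indicator
          (fun _ => ENNReal.ofReal (uniformWeight x p)) u := fun u => by
      by_cases h : (x, Ψ x u) ∈ bad p <;> simp [h]
    refine (lintegral_congr this).trans_le ?_
    rw [lintegral_indicator hsec, setLIntegral_const, mul_comm]
    exact mul_le_mul_left (hδ p x) _
  have hsub : {ω | (x ω, y ω) ∈ bad (σ ω)}
      ⊆ ⋃ p, {ω | σ ω = p} ∩ (fun ω => (x ω, y ω)) ⁻¹' bad p := by
    intro ω hω
    exact Set.mem_iUnion.2 ⟨σ ω, rfl, hω⟩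
  calc P {ω | (x ω, y ω) ∈ bad (σ ω)}
      ≤ ∑ p, P ({ω | σ ω = p} ∩ (fun ω => (x ω, y ω)) ⁻¹' bad p) :=
        (measure_mono hsub).trans (measure_iUnion_fintype_le _ _)
    _ ≤ ∑ p, ∫⁻ x, δ * ENNReal.ofReal (uniformWeight x p) ∂μn :=
        Finset.sum_le_sum fun p _ => hp p
    _ = ∫⁻ x, δ * ENNReal.ofReal (∑ p, uniformWeight x p) ∂μn := by
        rw [← lintegral_finsetSum _ fun p _ => (hwm p).const_mul δ]
        refine lintegral_congr fun x => ?_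
        rw [ENNReal.ofReal_sum_of_nonneg fun p _ => uniformWeight_nonneg x p, Finset.mul_sum]
    _ ≤ ∫⁻ _x, δ ∂μn := by
        refine lintegral_mono fun x => ?_
        refine (mul_le_mul_right (ENNReal.ofReal_le_ofReal (sum_uniformWeight_le x)) _).trans ?_
        simp
    _ = δ := by simp

/-- Conditionally on the `x`-values and the rearrangement, the sum of the distances between
neighbours stays within `o(n)` of its conditional mean. -/
lemma tendsto_adjSum_sub_pairMean {Xs Ys : ℕ → Ω → ℝ} (hX : ∀ i, Measurable (Xs i))
    (hY : ∀ i, Measurable (Ys i)) (hind : iIndepFun (fun i ω => (Xs i ω, Ys i ω)) P)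
    {μX μ : Measure ℝ} [IsProbabilityMeasure μX] [IsProbabilityMeasure μ] {κ : Kernel ℝ ℝ}
    [IsMarkovKernel κ] (hlaw : ∀ i, P.map (fun ω => (Xs i ω, Ys i ω)) = μX ⊗ₘ κ)
    {q : ℝ → ℝ → ℝ} (hqκ : ∀ t x, q t x = (κ x).real (Set.Ici t))
    (hq : Measurable (Function.uncurry q))
    {σ : (n : ℕ) → Ω → Equiv.Perm (Fin n)}
    (hσ : ∀ n, IsUniformRearrangement P (fun ω (i : Fin n) => Xs i ω)
      (fun ω (i : Fin n) => Ys i ω) (σ n)) :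
    ∀ᵐ ω ∂P, Tendsto (fun n : ℕ => (adjSum (fun i j : Fin n =>
        |μ.real (Set.Iic (Ys (σ n ω j) ω)) - μ.real (Set.Iic (Ys (σ n ω i) ω))|)
      - adjSum (fun i j : Fin n => pairMean μ q (Xs (σ n ω i) ω) (Xs (σ n ω j) ω))) / n)
      atTop (𝓝 0) := by
  obtain ⟨Φ, hΦ, hκ⟩ := κ.exists_measurable_map_eq_unitInterval
  set F : ℝ → ℝ := fun y => μ.real (Set.Iic y) with hF
  have hFmono : Monotone F := fun a b hab => measureReal_mono (Set.Iic_subset_Iic.2 hab)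
  have hFm : Measurable F := hFmono.measurable
  set f : ℝ → ℝ → ℝ := fun u v => |F v - F u| with hf
  have hfm : Measurable (Function.uncurry f) :=
    ((hFm.comp measurable_snd).sub (hFm.comp measurable_fst)).abs
  have hf01 : ∀ u v, f u v ∈ Set.Icc (0 : ℝ) 1 := by
    intro u v
    refine ⟨abs_nonneg _, ?_⟩
    have h1 : ∀ y, 0 ≤ F y := fun y => measureReal_nonneg
    have h2 : ∀ y, F y ≤ 1 := fun y => measureReal_le_one
    rw [hf, abs_le]
    constructor <;> linarith [h1 u, h2 u, h1 v, h2 v]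
  have hlaw' : ∀ i, P.map (fun ω => (Xs i ω, Ys i ω))
      = (μX.prod (volume : Measure unitInterval)).map fun w => (w.1, Φ w.1 w.2) := fun i => by
    rw [hlaw i, map_prod_eq_compProd hΦ hκ]
  have hmain : ∀ ε : ℝ, 0 < ε → ∀ᵐ ω ∂P, ∀ᶠ n : ℕ in atTop,
      |adjSum (fun i j : Fin n => f (Ys (σ n ω i) ω) (Ys (σ n ω j) ω))
        - adjSum (fun i j : Fin n => pairMean μ q (Xs (σ n ω i) ω) (Xs (σ n ω j) ω))| < ε * n := by
    intro ε hε
    set bad : (n : ℕ) → Equiv.Perm (Fin n) → Set ((Fin n → ℝ) × (Fin n → ℝ)) := fun n p =>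
      {z | ε * n ≤ |adjSum (fun i j : Fin n => f (z.2 (p i)) (z.2 (p j)))
        - adjSum (fun i j : Fin n => pairMean μ q (z.1 (p i)) (z.1 (p j)))|} with hbad
    have hbadm : ∀ n p, MeasurableSet (bad n p) := by
      intro n p
      refine measurableSet_le measurable_const (Measurable.abs (Measurable.sub ?_ ?_))
      · refine Finset.measurable_sum _ fun i _ => ?_
        split_ifs
        · exact hfm.comp (f := fun z : (Fin n → ℝ) × (Fin n → ℝ) => (z.2 _, z.2 _))
            (((measurable_pi_apply _).comp measurable_snd).prodMk
              ((measurable_pi_apply _).comp measurable_snd))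
        · exact measurable_const
      · refine Finset.measurable_sum _ fun i _ => ?_
        split_ifs
        · exact (measurable_pairMean hq).comp
            (f := fun z : (Fin n → ℝ) × (Fin n → ℝ) => (z.1 _, z.1 _))
            (((measurable_pi_apply _).comp measurable_fst).prodMk
              ((measurable_pi_apply _).comp measurable_fst))
        · exact measurable_const
    have hbound : ∀ n, P {ω | ((fun i : Fin n => Xs i ω), (fun i : Fin n => Ys i ω))
        ∈ bad n (σ n ω)} ≤ ENNReal.ofReal (4 * Real.exp (-(ε ^ 2 / 2 * n))) := by
      intro n
      have hΨ : Measurable (Function.uncurry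
          fun (x : Fin n → ℝ) (u : Fin n → unitInterval) (i : Fin n) => Φ (x i) (u i)) :=
        measurable_pi_lambda _ fun i => hΦ.comp
          (f := fun w : (Fin n → ℝ) × (Fin n → unitInterval) => (w.1 i, w.2 i))
          (((measurable_pi_apply i).comp measurable_fst).prodMk
            ((measurable_pi_apply i).comp measurable_snd))
      refine measure_perm_event_le (measurable_pi_lambda _ fun i : Fin n => hX i)
        (measurable_pi_lambda _ fun i : Fin n => hY i) (hσ n) hΨ
        (map_sample_eq hX hY hind hΦ hlaw' n) (hbadm n) fun p x => ?_
      set ρ : Measure (Fin n → unitInterval) :=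
        Measure.pi fun _ : Fin n => (volume : Measure unitInterval) with hρ
      have hΦx : ∀ x, Measurable (Φ x) := fun x => hΦ.comp measurable_prodMk_left
      have hη : iIndepFun (fun (i : Fin n) (u : Fin n → unitInterval) => Φ (x (p i)) (u (p i))) ρ :=
        (iIndepFun_pi (μ := fun _ : Fin n => (volume : Measure unitInterval))
          (X := fun i => Φ (x i)) fun i => (hΦx _).aemeasurable).precomp p.injective
      have hηm : ∀ i : Fin n, Measurable fun u : Fin n → unitInterval => Φ (x (p i)) (u (p i)) :=
        fun i => (hΦx _).comp (measurable_pi_apply _)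
      have hηlaw : ∀ i : Fin n, ρ.map (fun u : Fin n → unitInterval => Φ (x (p i)) (u (p i)))
          = κ (x (p i)) := by
        intro i
        have h1 := (measurePreserving_eval
          (fun _ : Fin n => (volume : Measure unitInterval)) (p i)).map_eq
        rw [← hκ, ← h1]
        exact (Measure.map_map (hΦx _) (measurable_pi_apply (p i))).symm
      have hmean : adjSum (fun i j : Fin n => ∫ u, f (Φ (x (p i)) (u (p i)))
          (Φ (x (p j)) (u (p j))) ∂ρ)
          = adjSum (fun i j : Fin n => pairMean μ q (x (p i)) (x (p j))) := by
        refine adjSum_congr fun i j hij => ?_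
        -- Neighbours have distinct indices, so their `y`-values are independent.
        have hne : i ≠ j := fun h => by rw [h] at hij; omega
        have h1 := (hη.indepFun hne).map_prod_eq_prod_map_map
          (hηm i).aemeasurable (hηm j).aemeasurable
        rw [hηlaw i, hηlaw j] at h1
        have h2 := integral_map (μ := ρ) ((hηm i).prodMk (hηm j)).aemeasurable
          (f := Function.uncurry f) hfm.aestronglyMeasurable
        rw [h1] at h2
        simp only [Function.uncurry] at h2
        rw [← h2, pairMean]
        simp only [hqκ]
        exact integral_abs_cdf_sub _ _ _
      have hdev := adjSum_deviation hη hηm hfm hf01 hε.le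
      rw [hmean] at hdev
      rw [← ofReal_measureReal]
      exact ENNReal.ofReal_le_ofReal hdev
    have hsum : ∑' n, P {ω | ((fun i : Fin n => Xs i ω), (fun i : Fin n => Ys i ω))
        ∈ bad n (σ n ω)} ≠ ⊤ := by
      have hs : Summable fun n : ℕ => 4 * Real.exp (-(ε ^ 2 / 2 * n)) := by
        refine Summable.mul_left _ ?_
        have := (Real.summable_exp_nat_mul_iff (a := -(ε ^ 2 / 2))).2 (by
          have : 0 < ε ^ 2 := by positivity
          linarith)
        refine this.congr fun n => ?_
        congr 1
        ring
      exact ne_top_of_le_ne_top (hs.tsum_ofReal_ne_top) (ENNReal.tsum_le_tsum hbound)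
    filter_upwards [ae_eventually_notMem hsum] with ω hω
    filter_upwards [hω] with n hn
    exact not_le.1 hn
  have hall : ∀ᵐ ω ∂P, ∀ k : ℕ, _ := ae_all_iff.2 fun k : ℕ =>
    hmain (1 / ((k : ℝ) + 1)) (by positivity)
  filter_upwards [hall] with ω hω
  rw [Metric.tendsto_atTop']
  intro ε hε
  obtain ⟨k, hk⟩ := exists_nat_one_div_lt hε
  obtain ⟨N, hN⟩ := eventually_atTop.1 (hω k)
  refine ⟨N, fun n hn => ?_⟩
  have hpos : (0 : ℝ) < n := by exact_mod_cast lt_of_le_of_lt (Nat.zero_le _) hn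
  rw [Real.dist_eq, sub_zero, abs_div, Nat.abs_cast, div_lt_iff₀ hpos]
  exact (hN n hn.le).trans (mul_lt_mul_of_pos_right hk hpos)

end Transfer

/-! ### Uniform convergence of the empirical distribution function -/

section GlivenkoCantelli

/-- A random variable with law `μ` has rank `F < c` with probability at most `c`. -/
lemma measureReal_cdf_lt_le (μ : Measure ℝ) [IsProbabilityMeasure μ] {c : ℝ} (hc : 0 ≤ c) :
    μ.real {y | μ.real (Set.Iic y) < c} ≤ c := by
  have hmono : Monotone fun y => μ.real (Set.Iic y) := fun a b hab =>
    measureReal_mono (Set.Iic_subset_Iic.2 hab)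
  have hB : MeasurableSet {y | μ.real (Set.Iic y) < c} :=
    measurableSet_lt hmono.measurable measurable_const
  refine ENNReal.toReal_le_of_le_ofReal hc ?_
  rw [hB.measure_eq_iSup_isCompact]
  refine iSup₂_le fun K hKB => iSup_le fun hK => ?_
  rcases K.eq_empty_or_nonempty with rfl | hne
  · simp
  · -- A compact set of points of small rank lies to the left of one of its points.
    obtain ⟨m, hm, hmax⟩ := hK.exists_isGreatest hne
    have h1 : μ.real (Set.Iic m) < c := hKB hm
    have hsub : K ⊆ Set.Iic m := fun y hy => hmax hy
    refine (measure_mono hsub).trans ?_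
    rw [← ofReal_measureReal]
    exact ENNReal.ofReal_le_ofReal h1.le

/-- The half-line up to the quantile of order `c` has measure at least `c`. It is written as a set
of lower bounds, so that nothing has to be assumed about the existence of the quantile. -/
lemma le_measureReal_quantile (μ : Measure ℝ) [IsProbabilityMeasure μ] {c : ℝ} (hc : c ≤ 1) :
    c ≤ μ.real {y | ∀ s, c ≤ μ.real (Set.Iic s) → y ≤ s} := by
  have hL : MeasurableSet {y | ∀ s, c ≤ μ.real (Set.Iic s) → y ≤ s} := by
    have : {y | ∀ s, c ≤ μ.real (Set.Iic s) → y ≤ s}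
        = ⋂ (s : ℝ) (_ : c ≤ μ.real (Set.Iic s)), Set.Iic s := by
      ext y; simp
    rw [this]
    exact (isClosed_iInter fun s => isClosed_iInter fun _ => isClosed_Iic).measurableSet
  have hcompl : μ.real {y | ∀ s, c ≤ μ.real (Set.Iic s) → y ≤ s}ᶜ ≤ 1 - c := by
    refine ENNReal.toReal_le_of_le_ofReal (sub_nonneg.2 hc) ?_
    rw [hL.compl.measure_eq_iSup_isCompact]
    refine iSup₂_le fun K hKB => iSup_le fun hK => ?_
    rcases K.eq_empty_or_nonempty with rfl | hne
    · simp
    · obtain ⟨m, hm, hmin⟩ := hK.exists_isLeast hne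
      have h1 := hKB hm
      simp only [Set.mem_compl_iff, Set.mem_ofPred_eq, not_forall, not_le] at h1
      obtain ⟨s, hs, hsm⟩ := h1
      have hsub : K ⊆ Set.Ioi s := fun y hy => lt_of_lt_of_le hsm (hmin hy)
      refine (measure_mono hsub).trans ?_
      rw [← ofReal_measureReal, ← Set.compl_Iic, probReal_compl_eq_one_sub measurableSet_Iic]
      exact ENNReal.ofReal_le_ofReal (by linarith)
  rw [probReal_compl_eq_one_sub hL] at hcompl
  linarith

variable {Ω : Type*} [MeasurableSpace Ω] {P : Measure Ω} [IsProbabilityMeasure P]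

/-- The number of entries of `y` that are at most `t`. -/
noncomputable def countLe {n : ℕ} (y : Fin n → ℝ) (t : ℝ) : ℕ :=
  (Finset.univ.filter fun j : Fin n => y j ≤ t).card

lemma countLe_eq_sum {n : ℕ} (y : Fin n → ℝ) (t : ℝ) :
    (countLe y t : ℝ) = ∑ j, (Set.Iic t).indicator (fun _ => (1 : ℝ)) (y j) := by
  simp [countLe, Set.indicator_apply]

/-- The **Glivenko–Cantelli theorem**, for an arbitrary law `μ`. It suffices to control the
empirical measures of finitely many lower sets `{F < k / K}` and of the half-lines up to the
quantiles of order `k / K`. -/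
lemma tendsto_countLe_uniform {Ys : ℕ → Ω → ℝ} (hm : ∀ i, Measurable (Ys i))
    (hind : iIndepFun Ys P) {μ : Measure ℝ} [IsProbabilityMeasure μ]
    (hlaw : ∀ i, P.map (Ys i) = μ) :
    ∀ᵐ ω ∂P, ∀ ε > 0, ∀ᶠ n : ℕ in atTop, ∀ t,
      |(countLe (fun i : Fin n => Ys i ω) t : ℝ) / n - μ.real (Set.Iic t)| ≤ ε := by
  classical
  set F : ℝ → ℝ := fun y => μ.real (Set.Iic y) with hF
  have hmono : Monotone F := fun a b hab => measureReal_mono (Set.Iic_subset_Iic.2 hab)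
  set B : ℝ → Set ℝ := fun c => {y | F y < c} with hBdef
  set L : ℝ → Set ℝ := fun c => {y | ∀ s, c ≤ F s → y ≤ s} with hLdef
  have hB : ∀ c, MeasurableSet (B c) := fun c => measurableSet_lt hmono.measurable measurable_const
  have hL : ∀ c, MeasurableSet (L c) := by
    intro c
    have : L c = ⋂ (s : ℝ) (_ : c ≤ F s), Set.Iic s := by
      ext y; simp [hLdef]
    rw [this]
    exact (isClosed_iInter fun s => isClosed_iInter fun _ => isClosed_Iic).measurableSet
  have hfreq : ∀ S : Set ℝ, MeasurableSet S → ∀ᵐ ω ∂P, Tendsto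
      (fun n : ℕ => (∑ i : Fin n, S.indicator (fun _ => (1 : ℝ)) (Ys i ω)) / n) atTop
      (𝓝 (μ.real S)) := by
    intro S hS
    have := tendsto_sample_mean hm hind hlaw (h := S.indicator fun _ => (1 : ℝ))
      (measurable_const.indicator hS) (C := 1) fun z => by
        simp only [Set.indicator_apply]; split_ifs <;> simp
    rwa [integral_indicator hS, setIntegral_const, smul_eq_mul, mul_one] at this
  have h1 : ∀ᵐ ω ∂P, ∀ K k : ℕ, _ := ae_all_iff.2 fun K : ℕ => ae_all_iff.2 fun k : ℕ =>
    hfreq (B ((k : ℝ) / K)) (hB _)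
  have h2 : ∀ᵐ ω ∂P, ∀ K k : ℕ, _ := ae_all_iff.2 fun K : ℕ => ae_all_iff.2 fun k : ℕ =>
    hfreq (L ((k : ℝ) / K)) (hL _)
  filter_upwards [h1, h2] with ω hω1 hω2 ε hε
  obtain ⟨K', hK'⟩ := exists_nat_one_div_lt (half_pos hε)
  set K : ℕ := K' + 1 with hKdef
  have hK : (0 : ℝ) < K := by positivity
  have hKε : 1 / (K : ℝ) < ε / 2 := by rw [hKdef]; push_cast; exact hK'
  have e1 : ∀ᶠ n : ℕ in atTop, ∀ k ∈ Finset.range (K + 2),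
      (∑ i : Fin n, (B ((k : ℝ) / K)).indicator (fun _ => (1 : ℝ)) (Ys i ω)) / n
        < μ.real (B ((k : ℝ) / K)) + ε / 2 :=
    (Finset.eventually_all _).2 fun k _ =>
      (hω1 K k).eventually (gt_mem_nhds (by linarith))
  have e2 : ∀ᶠ n : ℕ in atTop, ∀ k ∈ Finset.range (K + 2),
      μ.real (L ((k : ℝ) / K)) - ε / 2
        < (∑ i : Fin n, (L ((k : ℝ) / K)).indicator (fun _ => (1 : ℝ)) (Ys i ω)) / n :=
    (Finset.eventually_all _).2 fun k _ =>
      (hω2 K k).eventually (lt_mem_nhds (by linarith))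
  filter_upwards [e1, e2] with n g1 g2 t
  have hF0 : 0 ≤ F t := measureReal_nonneg
  have hF1 : F t ≤ 1 := measureReal_le_one
  -- The level `k / K` just below `F t` brackets `(-∞, t]` between two of the finitely many sets.
  set k : ℕ := ⌊K * F t⌋₊ with hk
  have hk1 : (k : ℝ) / K ≤ F t := by
    rw [div_le_iff₀ hK, mul_comm]
    exact Nat.floor_le (by positivity)
  have hk2 : F t < ((k + 1 : ℕ) : ℝ) / K := by
    rw [lt_div_iff₀ hK, mul_comm]
    push_cast
    exact Nat.lt_floor_add_one _
  have hkK : k ≤ K := by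
    have : (k : ℝ) ≤ K := by
      rw [div_le_iff₀ hK] at hk1
      nlinarith
    exact_mod_cast this
  have hsub1 : Set.Iic t ⊆ B (((k + 1 : ℕ) : ℝ) / K) := fun y hy => lt_of_le_of_lt (hmono hy) hk2
  have hsub2 : L ((k : ℝ) / K) ⊆ Set.Iic t := fun y hy => hy t hk1
  have hsum : ∀ S T : Set ℝ, S ⊆ T →
      (∑ i : Fin n, S.indicator (fun _ => (1 : ℝ)) (Ys i ω)) / n
        ≤ (∑ i : Fin n, T.indicator (fun _ => (1 : ℝ)) (Ys i ω)) / n := fun S T hST =>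
    div_le_div_of_nonneg_right (Finset.sum_le_sum fun i _ =>
      Set.indicator_le_indicator_of_subset hST (fun _ => zero_le_one) _) n.cast_nonneg
  have u1 := hsum _ _ hsub1
  have u2 := hsum _ _ hsub2
  have v1 := g1 (k + 1) (Finset.mem_range.2 (by omega))
  have v2 := g2 k (Finset.mem_range.2 (by omega))
  have w1 : μ.real (B (((k + 1 : ℕ) : ℝ) / K)) ≤ ((k + 1 : ℕ) : ℝ) / K :=
    measureReal_cdf_lt_le μ (by positivity)
  have w2 : (k : ℝ) / K ≤ μ.real (L ((k : ℝ) / K)) :=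
    le_measureReal_quantile μ (hk1.trans hF1)
  have hsplit : ((k + 1 : ℕ) : ℝ) / K = (k : ℝ) / K + 1 / K := by push_cast; rw [add_div]
  rw [countLe_eq_sum, abs_le]
  change -ε ≤ _ - F t ∧ _ - F t ≤ ε
  constructor <;> linarith

end GlivenkoCantelli

/-! ### Ranks -/

section Ranks

lemma rankLe_eq_countLe {n : ℕ} (y : Fin n → ℝ) (p : Equiv.Perm (Fin n)) (i : Fin n) :
    rankLe y p i = countLe y (y (p i)) := by
  unfold rankLe countLe
  refine Finset.card_bij (fun j _ => p j) (fun j hj => ?_) (fun a _ b _ h => p.injective h)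
    fun b hb => ⟨p.symm b, ?_, by simp⟩
  · simpa using hj
  · simpa using hb

lemma rankGe_eq_countLe {n : ℕ} (y : Fin n → ℝ) (p : Equiv.Perm (Fin n)) (i : Fin n) :
    rankGe y p i = countLe (fun j => -y j) (-y (p i)) := by
  unfold rankGe countLe
  refine Finset.card_bij (fun j _ => p j) (fun j hj => ?_) (fun a _ b _ h => p.injective h)
    fun b hb => ⟨p.symm b, ?_, by simp⟩
  · simpa using hj
  · simpa using hb

lemma countLe_le {n : ℕ} (y : Fin n → ℝ) (t : ℝ) : countLe y t ≤ n :=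
  (Finset.card_filter_le _ _).trans_eq (by simp)

/-- Ranks divided by the sample size may be replaced by the distribution function. -/
lemma abs_adjSum_rankLe_sub_le {n : ℕ} {y : Fin n → ℝ} {F : ℝ → ℝ} {ε : ℝ} (hε : 0 ≤ ε)
    (h : ∀ t, |(countLe y t : ℝ) / n - F t| ≤ ε) (p : Equiv.Perm (Fin n)) :
    |adjSum (fun i j => |(rankLe y p j : ℝ) - rankLe y p i|) / (n : ℝ) ^ 2
      - adjSum (fun i j => |F (y (p j)) - F (y (p i))|) / n| ≤ 2 * ε := by
  rcases Nat.eq_zero_or_pos n with hn | hn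
  · subst hn
    simpa using hε
  have hn' : (0 : ℝ) < n := by exact_mod_cast hn
  have h1 : adjSum (fun i j => |(rankLe y p j : ℝ) - rankLe y p i|) / (n : ℝ) ^ 2
      = adjSum (fun i j => |(rankLe y p j : ℝ) / n - (rankLe y p i : ℝ) / n|) / n := by
    rw [sq, ← div_div, ← adjSum_div]
    simp_rw [← sub_div, abs_div, Nat.abs_cast]
  rw [h1, ← sub_div, ← adjSum_sub, abs_div, Nat.abs_cast, div_le_iff₀ hn', mul_comm]
  refine (abs_adjSum_le _).trans
    ((adjSum_le fun i j => ?_).trans (adjSum_const_le (c := 2 * ε) (by positivity)))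
  refine (abs_abs_sub_abs_le_abs_sub _ _).trans ?_
  rw [rankLe_eq_countLe, rankLe_eq_countLe]
  have e1 := abs_le.1 (h (y (p i)))
  have e2 := abs_le.1 (h (y (p j)))
  rw [abs_le]
  constructor <;> linarith

variable {Ω : Type*} [MeasurableSpace Ω] {P : Measure Ω} [IsProbabilityMeasure P]

/-- The normalized denominator of `ξ_n` converges to the integral of `Var(1_{Y ≥ t})`. -/
lemma tendsto_sum_rankGe {Ys : ℕ → Ω → ℝ} (hm : ∀ i, Measurable (Ys i))
    (hind : iIndepFun Ys P) {μ : Measure ℝ} [IsProbabilityMeasure μ]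
    (hlaw : ∀ i, P.map (Ys i) = μ) (σ : (n : ℕ) → Ω → Equiv.Perm (Fin n)) :
    ∀ᵐ ω ∂P, Tendsto (fun n : ℕ => (∑ i : Fin n, (rankGe (fun j : Fin n => Ys j ω) (σ n ω) i : ℝ)
        * (n - rankGe (fun j : Fin n => Ys j ω) (σ n ω) i)) / (n : ℝ) ^ 3) atTop
      (𝓝 (∫ t, μ.real (Set.Ici t) * (1 - μ.real (Set.Ici t)) ∂μ)) := by
  set G : ℝ → ℝ := fun t => μ.real (Set.Ici t) with hG
  have hGm : Measurable G :=
    (show Antitone G from fun a b hab => measureReal_mono (Set.Ici_subset_Ici.2 hab)).measurable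
  have hG01 : ∀ t, G t ∈ Set.Icc (0 : ℝ) 1 := fun t => ⟨measureReal_nonneg, measureReal_le_one⟩
  have hneg : IsProbabilityMeasure (μ.map fun y => -y) :=
    Measure.isProbabilityMeasure_map measurable_neg.aemeasurable
  have hgc := tendsto_countLe_uniform (Ys := fun i ω => -Ys i ω) (fun i => (hm i).neg)
    (hind.comp (fun _ y => -y) fun _ => measurable_neg) (μ := μ.map fun y => -y) fun i => by
      rw [← hlaw i, Measure.map_map measurable_neg (hm i)]
      rfl
  have hcdf : ∀ t, (μ.map fun y => -y).real (Set.Iic (-t)) = G t := by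
    intro t
    rw [map_measureReal_apply measurable_neg measurableSet_Iic, hG]
    congr 1
    ext y
    simp
  have hslln := tendsto_sample_mean hm hind hlaw (h := fun t => G t * (1 - G t))
    (hGm.mul (hGm.const_sub 1)) (C := 1) fun t => by
      obtain ⟨h1, h2⟩ := hG01 t
      rw [abs_le]
      constructor <;> nlinarith
  filter_upwards [hgc, hslln] with ω h1 h2
  have hclose : Tendsto (fun n : ℕ =>
      (∑ i : Fin n, (rankGe (fun j : Fin n => Ys j ω) (σ n ω) i : ℝ)
        * (n - rankGe (fun j : Fin n => Ys j ω) (σ n ω) i)) / (n : ℝ) ^ 3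
      - (∑ i : Fin n, G (Ys i ω) * (1 - G (Ys i ω))) / n) atTop (𝓝 0) := by
    rw [Metric.tendsto_atTop']
    intro ε hε
    obtain ⟨N, hN⟩ := eventually_atTop.1 (h1 (ε / 2) (half_pos hε))
    refine ⟨N, fun n hn => ?_⟩
    have hpos : (0 : ℝ) < n := by exact_mod_cast lt_of_le_of_lt (Nat.zero_le _) hn
    have hperm : ∑ i : Fin n, G (Ys i ω) * (1 - G (Ys i ω))
        = ∑ i : Fin n, G (Ys (σ n ω i) ω) * (1 - G (Ys (σ n ω i) ω)) :=
      (Equiv.sum_comp (σ n ω) fun i : Fin n => G (Ys i ω) * (1 - G (Ys i ω))).symm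
    have hscale : (∑ i : Fin n, (rankGe (fun j : Fin n => Ys j ω) (σ n ω) i : ℝ)
        * (n - rankGe (fun j : Fin n => Ys j ω) (σ n ω) i)) / (n : ℝ) ^ 3
        = (∑ i : Fin n, (rankGe (fun j : Fin n => Ys j ω) (σ n ω) i : ℝ) / n
          * (1 - (rankGe (fun j : Fin n => Ys j ω) (σ n ω) i : ℝ) / n)) / n := by
      rw [Finset.sum_div, Finset.sum_div]
      refine Finset.sum_congr rfl fun i _ => ?_
      field_simp
    rw [Real.dist_eq, sub_zero, hscale, hperm, ← sub_div, abs_div, Nat.abs_cast,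
      div_lt_iff₀ hpos, ← Finset.sum_sub_distrib]
    refine ((Finset.abs_sum_le_sum_abs _ _).trans (Finset.sum_le_sum (g := fun _ => ε / 2)
      fun i _ => ?_)).trans_lt ?_
    · have e := hN n hn.le (-Ys (σ n ω i) ω)
      rw [hcdf] at e
      rw [rankGe_eq_countLe]
      set g : ℝ := (countLe (fun j : Fin n => -Ys j ω) (-Ys (σ n ω i) ω) : ℝ) / n with hg
      have hg0 : 0 ≤ g := by positivity
      have hg1 : g ≤ 1 := div_le_one_of_le₀ (by exact_mod_cast countLe_le _ _) n.cast_nonneg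
      obtain ⟨hG0, hG1⟩ := hG01 (Ys (σ n ω i) ω)
      have : g * (1 - g) - G (Ys (σ n ω i) ω) * (1 - G (Ys (σ n ω i) ω))
          = (1 - g - G (Ys (σ n ω i) ω)) * (g - G (Ys (σ n ω i) ω)) := by ring
      rw [this, abs_mul]
      refine (mul_le_of_le_one_left (abs_nonneg _) ?_).trans e
      rw [abs_le]
      constructor <;> linarith
    · simp only [Finset.sum_const, Finset.card_univ, Fintype.card_fin, nsmul_eq_mul]
      nlinarith
  simpa using hclose.add h2

end Ranks

/-! ### From almost every threshold to every threshold -/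

lemma measureReal_Ici_eq_add (μ : Measure ℝ) [IsFiniteMeasure μ] {t a : ℝ} (h : t ≤ a) :
    μ.real (Set.Ici t) = μ.real (Set.Ico t a) + μ.real (Set.Ici a) := by
  rw [← Set.Ico_union_Ici_eq_Ici h]
  refine measureReal_union (Set.disjoint_left.2 fun y hy hy' => ?_) measurableSet_Ici
  exact absurd hy.2 (not_lt.2 hy')

/-- A function of the threshold `t` that is dominated by `μ [t, ∞)`, grows from `a` down to `t` by
at most `μ [t, a)` and vanishes for `μ`-almost every threshold is nowhere positive: by inner
regularity, `[t, ∞)` agrees up to small measure with some `[a, ∞)` where `a` is a good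
threshold. -/
lemma le_zero_of_ae_eq_zero {μ : Measure ℝ} [IsFiniteMeasure μ] {v : ℝ → ℝ}
    (h1 : ∀ t, v t ≤ μ.real (Set.Ici t))
    (h2 : ∀ t a, t ≤ a → v t ≤ v a + μ.real (Set.Ico t a)) (hae : ∀ᵐ t ∂μ, v t = 0) (t : ℝ) :
    v t ≤ 0 := by
  refine le_of_forall_pos_le_add fun ε hε => ?_
  rw [zero_add]
  set N : Set ℝ := toMeasurable μ {t | ¬ v t = 0} with hN
  have hN0 : μ N = 0 := by rw [hN, measure_toMeasurable]; exact ae_iff.1 hae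
  have hSm : MeasurableSet (Set.Ici t \ N) :=
    measurableSet_Ici.diff (measurableSet_toMeasurable _ _)
  obtain ⟨K, hKS, hK, hlt⟩ := hSm.exists_isCompact_lt_add (measure_ne_top μ _)
    (ENNReal.ofReal_pos.2 hε).ne'
  rw [measure_sdiff_null hN0] at hlt
  have hlt' : μ.real (Set.Ici t) < μ.real K + ε := by
    have := (ENNReal.toReal_lt_toReal (measure_ne_top _ _)
      (ENNReal.add_ne_top.2 ⟨measure_ne_top _ _, ENNReal.ofReal_ne_top⟩)).2 hlt
    rwa [ENNReal.toReal_add (measure_ne_top _ _) ENNReal.ofReal_ne_top,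
      ENNReal.toReal_ofReal hε.le] at this
  rcases K.eq_empty_or_nonempty with rfl | hne
  · rw [measureReal_empty, zero_add] at hlt'
    exact (h1 t).trans hlt'.le
  · obtain ⟨m, hm, hmin⟩ := hK.exists_isLeast hne
    have hmS := hKS hm
    have htm : t ≤ m := hmS.1
    have hvm : v m = 0 := by
      by_contra hcon
      exact hmS.2 (subset_toMeasurable μ _ hcon)
    have hKm : K ⊆ Set.Ici m := fun y hy => hmin hy
    have hsplit := measureReal_Ici_eq_add μ htm
    have hmono : μ.real K ≤ μ.real (Set.Ici m) := measureReal_mono hKm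
    have := h2 t m htm
    rw [hvm] at this
    linarith

/-- A probability measure on the line that gives every rational half-line measure zero or one is
concentrated at a point. -/
lemma exists_ae_eq_of_zero_one {ρ : Measure ℝ} [IsProbabilityMeasure ρ]
    (h : ∀ r : ℚ, ρ.real (Set.Ici (r : ℝ)) * (1 - ρ.real (Set.Ici (r : ℝ))) = 0) :
    ∃ c, ∀ᵐ y ∂ρ, y = c := by
  have hr : ∀ r : ℚ, ∀ᵐ y ∂ρ, ((r : ℝ) ≤ y ↔ ρ.real (Set.Ici (r : ℝ)) = 1) := by
    intro r
    rcases mul_eq_zero.1 (h r) with h0 | h1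
    · have hnull : ρ (Set.Ici (r : ℝ)) = 0 := by
        rwa [measureReal_eq_zero_iff] at h0
      filter_upwards [measure_eq_zero_iff_ae_notMem.1 hnull] with y hy
      rw [h0]
      simpa using hy
    · have h1' : ρ.real (Set.Ici (r : ℝ)) = 1 := by linarith
      have hcompl : ρ.real (Set.Ici (r : ℝ))ᶜ = 0 := by
        rw [probReal_compl_eq_one_sub measurableSet_Ici, h1', sub_self]
      rw [measureReal_eq_zero_iff] at hcompl
      filter_upwards [measure_eq_zero_iff_ae_notMem.1 hcompl] with y hy
      rw [h1']
      simpa using hy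
  have hall := ae_all_iff.2 hr
  obtain ⟨c, hc⟩ := hall.exists
  refine ⟨c, ?_⟩
  filter_upwards [hall] with y hy
  refine eq_of_forall_lt_rat_iff_lt fun r => ?_
  rw [← not_le, ← not_le, hy r, hc r]

/-! ### The dependence measure -/

section Limit

variable {Ω : Type*} [MeasurableSpace Ω] {P : Measure Ω} [IsProbabilityMeasure P] {X Y : Ω → ℝ}

/-- A regular version of the conditional probability of `Y ≥ t` given `X = x`. -/
noncomputable def condTail (P : Measure Ω) [IsProbabilityMeasure P] (X Y : Ω → ℝ) (t x : ℝ) : ℝ :=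
  (condDistrib Y X P x).real (Set.Ici t)

lemma condTail_mem_Icc (t x : ℝ) : condTail P X Y t x ∈ Set.Icc (0 : ℝ) 1 :=
  ⟨measureReal_nonneg, measureReal_le_one⟩

lemma measurable_condTail : Measurable (Function.uncurry (condTail P X Y)) := by
  have hs : MeasurableSet {z : (ℝ × ℝ) × ℝ | z.1.1 ≤ z.2} :=
    measurableSet_le measurable_fst.fst measurable_snd
  have := Kernel.measurable_kernel_prodMk_left (κ := Kernel.prodMkLeft ℝ (condDistrib Y X P)) hs
  exact this.ennreal_toReal

lemma condExp_upInd (hX : Measurable X) (hY : Measurable Y) (t : ℝ) :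
    P[upInd Y t | MeasurableSpace.comap X inferInstance] =ᵐ[P] fun ω => condTail P X Y t (X ω) :=
  (condDistrib_ae_eq_condExp hX hY measurableSet_Ici).symm

lemma integrable_upInd (hY : Measurable Y) (t : ℝ) : Integrable (upInd Y t) P :=
  (integrable_const _).indicator (hY measurableSet_Ici)

omit [IsProbabilityMeasure P] in
lemma integral_upInd (hY : Measurable Y) (t : ℝ) :
    ∫ ω, upInd Y t ω ∂P = (P.map Y).real (Set.Ici t) := by
  rw [map_measureReal_apply hY measurableSet_Ici]
  exact (integral_indicator (hY measurableSet_Ici)).trans (by simp)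

lemma measurable_condTail_right (t : ℝ) : Measurable (condTail P X Y t) :=
  measurable_condTail.comp measurable_prodMk_left

lemma integrable_condTail {ν : Measure ℝ} [IsFiniteMeasure ν] (t : ℝ) :
    Integrable (condTail P X Y t) ν :=
  Integrable.of_mem_Icc 0 1 (measurable_condTail_right t).aemeasurable
    (ae_of_all _ fun x => condTail_mem_Icc t x)

lemma integral_condTail (hX : Measurable X) (hY : Measurable Y) (t : ℝ) :
    ∫ x, condTail P X Y t x ∂(P.map X) = (P.map Y).real (Set.Ici t) := by
  rw [integral_map hX.aemeasurable (measurable_condTail_right t).aestronglyMeasurable,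
    ← integral_congr_ae (condExp_upInd hX hY t), integral_condExp hX.comap_le, integral_upInd hY]

lemma memLp_of_mem_Icc {α : Type*} [MeasurableSpace α] {ν : Measure α} [IsFiniteMeasure ν]
    {f : α → ℝ} (hf : AEMeasurable f ν) (h : ∀ x, f x ∈ Set.Icc (0 : ℝ) 1) : MemLp f 2 ν :=
  MemLp.of_bound hf.aestronglyMeasurable 1 (ae_of_all _ fun x => by
    rw [Real.norm_eq_abs, abs_of_nonneg (h x).1]; exact (h x).2)

lemma varInd_eq (hY : Measurable Y) (t : ℝ) :
    varInd P Y t = (P.map Y).real (Set.Ici t) * (1 - (P.map Y).real (Set.Ici t)) := by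
  have hmem : ∀ ω, upInd Y t ω ∈ Set.Icc (0 : ℝ) 1 := by
    classical
    intro ω
    simp only [upInd, Set.indicator_apply]
    split_ifs <;> simp
  have hsq : (upInd Y t) ^ 2 = upInd Y t := by
    classical
    ext ω
    simp only [upInd, Pi.pow_apply, Set.indicator_apply]
    split_ifs <;> simp
  rw [varInd, variance_eq_sub (memLp_of_mem_Icc (integrable_upInd hY t).aemeasurable hmem), hsq,
    integral_upInd hY]
  ring

lemma varCond_eq_variance (hX : Measurable X) (hY : Measurable Y) (t : ℝ) :
    varCond P X Y t = variance (fun ω => condTail P X Y t (X ω)) P :=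
  variance_congr (condExp_upInd hX hY t)

lemma varCond_eq (hX : Measurable X) (hY : Measurable Y) (t : ℝ) :
    varCond P X Y t =
      ∫ x, condTail P X Y t x ^ 2 ∂(P.map X) - (P.map Y).real (Set.Ici t) ^ 2 := by
  have hm := measurable_condTail_right (P := P) (X := X) (Y := Y) t
  have hLp : MemLp (fun ω => condTail P X Y t (X ω)) 2 P :=
    memLp_of_mem_Icc (hm.comp hX).aemeasurable fun ω => condTail_mem_Icc _ _
  rw [varCond_eq_variance hX hY, variance_eq_sub hLp,
    integral_map hX.aemeasurable (hm.pow_const 2).aestronglyMeasurable, ← integral_condTail hX hY,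
    integral_map hX.aemeasurable hm.aestronglyMeasurable]
  rfl

/-- The mean conditional variance of the indicator of `Y ≥ t` given `X`. -/
noncomputable def meanCondVar (P : Measure Ω) [IsProbabilityMeasure P] (X Y : Ω → ℝ) (t : ℝ) : ℝ :=
  ∫ x, condTail P X Y t x * (1 - condTail P X Y t x) ∂(P.map X)

lemma meanCondVar_integrand_mem_Icc (t x : ℝ) :
    condTail P X Y t x * (1 - condTail P X Y t x) ∈ Set.Icc (0 : ℝ) 1 := by
  obtain ⟨h1, h2⟩ := condTail_mem_Icc (P := P) (X := X) (Y := Y) t x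
  constructor <;> nlinarith

lemma meanCondVar_nonneg (t : ℝ) : 0 ≤ meanCondVar P X Y t :=
  integral_nonneg fun x => (meanCondVar_integrand_mem_Icc t x).1

lemma integrable_meanCondVar_integrand {ν : Measure ℝ} [IsFiniteMeasure ν] (t : ℝ) :
    Integrable (fun x => condTail P X Y t x * (1 - condTail P X Y t x)) ν :=
  Integrable.of_mem_Icc 0 1 ((measurable_condTail_right t).mul
    ((measurable_condTail_right t).const_sub 1)).aemeasurable
    (ae_of_all _ fun x => meanCondVar_integrand_mem_Icc t x)

/-- The law of total variance for the indicator of `Y ≥ t`. -/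
lemma varCond_add_meanCondVar (hX : Measurable X) (hY : Measurable Y) (t : ℝ) :
    varCond P X Y t + meanCondVar P X Y t = varInd P Y t := by
  have hpm : IsProbabilityMeasure (P.map X) := Measure.isProbabilityMeasure_map hX.aemeasurable
  have h1 := integrable_condTail (P := P) (X := X) (Y := Y) (ν := P.map X) t
  have h2 := integrable_meanCondVar_integrand (P := P) (X := X) (Y := Y) (ν := P.map X) t
  have hsq : ∫ x, condTail P X Y t x ^ 2 ∂(P.map X)
      = (P.map Y).real (Set.Ici t) - meanCondVar P X Y t := by
    rw [← integral_condTail hX hY, meanCondVar, ← integral_sub h1 h2]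
    refine integral_congr_ae (ae_of_all _ fun x => ?_)
    ring
  rw [varCond_eq hX hY, varInd_eq hY, hsq]
  ring

lemma measurable_varInd (hY : Measurable Y) : Measurable (varInd P Y) := by
  have hGm : Measurable fun t => (P.map Y).real (Set.Ici t) :=
    (show Antitone fun t => (P.map Y).real (Set.Ici t) from fun a b hab =>
      measureReal_mono (Set.Ici_subset_Ici.2 hab)).measurable
  rw [funext (varInd_eq hY)]
  exact hGm.mul (hGm.const_sub 1)

lemma varInd_mem_Icc (hY : Measurable Y) (t : ℝ) : varInd P Y t ∈ Set.Icc (0 : ℝ) 1 := by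
  have hpm : IsProbabilityMeasure (P.map Y) := Measure.isProbabilityMeasure_map hY.aemeasurable
  have h1 : 0 ≤ (P.map Y).real (Set.Ici t) := measureReal_nonneg
  have h2 : (P.map Y).real (Set.Ici t) ≤ 1 := measureReal_le_one
  rw [varInd_eq hY]
  constructor <;> nlinarith

lemma integrable_varInd (hY : Measurable Y) : Integrable (varInd P Y) (P.map Y) :=
  Integrable.of_mem_Icc 0 1 (measurable_varInd hY).aemeasurable
    (ae_of_all _ fun t => varInd_mem_Icc hY t)

lemma measurable_meanCondVar (hX : Measurable X) : Measurable (meanCondVar P X Y) := by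
  have hpm : IsProbabilityMeasure (P.map X) := Measure.isProbabilityMeasure_map hX.aemeasurable
  have hm : Measurable fun z : ℝ × ℝ => condTail P X Y z.1 z.2 := measurable_condTail
  exact ((hm.mul (hm.const_sub 1)).stronglyMeasurable.integral_prod_right (ν := P.map X)).measurable

omit [IsProbabilityMeasure P] in
lemma varCond_nonneg (t : ℝ) : 0 ≤ varCond P X Y t := variance_nonneg _ _

lemma meanCondVar_le_varInd (hX : Measurable X) (hY : Measurable Y) (t : ℝ) :
    meanCondVar P X Y t ≤ varInd P Y t := by
  rw [← varCond_add_meanCondVar hX hY]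
  exact le_add_of_nonneg_left (varCond_nonneg t)

lemma integrable_meanCondVar (hX : Measurable X) (hY : Measurable Y) :
    Integrable (meanCondVar P X Y) (P.map Y) :=
  Integrable.of_mem_Icc 0 1 (measurable_meanCondVar hX).aemeasurable (ae_of_all _ fun t =>
    ⟨meanCondVar_nonneg t, (meanCondVar_le_varInd hX hY t).trans (varInd_mem_Icc hY t).2⟩)

lemma varCond_eq_sub (hX : Measurable X) (hY : Measurable Y) :
    varCond P X Y = fun t => varInd P Y t - meanCondVar P X Y t := by
  ext t
  rw [← varCond_add_meanCondVar hX hY, add_sub_cancel_right]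

lemma integrable_varCond (hX : Measurable X) (hY : Measurable Y) :
    Integrable (varCond P X Y) (P.map Y) := by
  rw [varCond_eq_sub hX hY]
  exact (integrable_varInd hY).sub (integrable_meanCondVar hX hY)

lemma integral_varCond (hX : Measurable X) (hY : Measurable Y) :
    ∫ t, varCond P X Y t ∂(P.map Y) =
      ∫ t, varInd P Y t ∂(P.map Y) - ∫ t, meanCondVar P X Y t ∂(P.map Y) := by
  rw [varCond_eq_sub hX hY]
  exact integral_sub (integrable_varInd hY) (integrable_meanCondVar hX hY)

/-- The denominator of `ξ` is positive unless `Y` is almost surely constant. -/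
lemma integral_varInd_pos (hY : Measurable Y) (hYc : ¬ ∃ c : ℝ, Y =ᵐ[P] fun _ => c) :
    0 < ∫ t, varInd P Y t ∂(P.map Y) := by
  have hpm : IsProbabilityMeasure (P.map Y) := Measure.isProbabilityMeasure_map hY.aemeasurable
  by_contra hcon
  refine hYc ?_
  have h0 : ∫ t, varInd P Y t ∂(P.map Y) = 0 :=
    le_antisymm (not_lt.1 hcon) (integral_nonneg fun t => (varInd_mem_Icc hY t).1)
  have hae := (integral_eq_zero_iff_of_nonneg (fun t => (varInd_mem_Icc hY t).1)
    (integrable_varInd hY)).1 h0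
  have hall : ∀ t, varInd P Y t ≤ 0 := by
    refine le_zero_of_ae_eq_zero (μ := P.map Y) (fun t => ?_) (fun t a hta => ?_) hae
    · rw [varInd_eq hY]
      have h1 : 0 ≤ (P.map Y).real (Set.Ici t) := measureReal_nonneg
      nlinarith
    · rw [varInd_eq hY, varInd_eq hY]
      have h1 := measureReal_Ici_eq_add (P.map Y) hta
      have h2 : 0 ≤ (P.map Y).real (Set.Ici a) := measureReal_nonneg
      have h3 : 0 ≤ (P.map Y).real (Set.Ico t a) := measureReal_nonneg
      rw [h1]
      nlinarith
  obtain ⟨c, hc⟩ := exists_ae_eq_of_zero_one (ρ := P.map Y) fun r => by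
    rw [← varInd_eq hY]
    exact le_antisymm (hall r) (varInd_mem_Icc hY r).1
  exact ⟨c, ae_of_ae_map hY.aemeasurable hc⟩

lemma varCond_eq_zero_of_indepFun (hX : Measurable X) (hY : Measurable Y)
    (h : IndepFun X Y P) (t : ℝ) : varCond P X Y t = 0 := by
  have hmeas : StronglyMeasurable[MeasurableSpace.comap Y inferInstance] (upInd Y t) :=
    StronglyMeasurable.indicator stronglyMeasurable_const ⟨Set.Ici t, measurableSet_Ici, rfl⟩
  have hce := condExp_indep_eq hY.comap_le hX.comap_le hmeas
    ((IndepFun_iff_Indep _ _ _).1 h.symm)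
  rw [varCond, variance_congr hce]
  simp [variance_eq_integral aemeasurable_const]

lemma indepFun_of_integral_varCond_eq_zero (hX : Measurable X) (hY : Measurable Y)
    (h0 : ∫ t, varCond P X Y t ∂(P.map Y) = 0) : IndepFun X Y P := by
  have hpm : IsProbabilityMeasure (P.map Y) := Measure.isProbabilityMeasure_map hY.aemeasurable
  have hae := (integral_eq_zero_iff_of_nonneg (fun t => varCond_nonneg t)
    (integrable_varCond hX hY)).1 h0
  rw [indepFun_iff_measure_inter_preimage_eq_mul]
  intro B S hB hS
  have hXB : MeasurableSet (X ⁻¹' B) := hX hB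
  -- The joint and the product measure of `X⁻¹ B ∩ Y⁻¹ ·` agree on almost every half-line.
  have hgood : ∀ᵐ t ∂(P.map Y), |P.real (X ⁻¹' B ∩ Y ⁻¹' Set.Ici t)
      - P.real (X ⁻¹' B) * P.real (Y ⁻¹' Set.Ici t)| = 0 := by
    filter_upwards [hae] with t ht
    have ht' : variance (fun ω => condTail P X Y t (X ω)) P = 0 := by
      rw [← varCond_eq_variance hX hY]; exact ht
    have hconst := ae_eq_integral_of_variance_eq_zero (X := fun ω => condTail P X Y t (X ω))
      (memLp_of_mem_Icc ((measurable_condTail_right t).comp hX).aemeasurable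
        fun ω => condTail_mem_Icc _ _) ht'
    have hmean : ∫ ω, condTail P X Y t (X ω) ∂P = P.real (Y ⁻¹' Set.Ici t) := by
      rw [← integral_map hX.aemeasurable (measurable_condTail_right t).aestronglyMeasurable,
        integral_condTail hX hY, map_measureReal_apply hY measurableSet_Ici]
    rw [hmean] at hconst
    have hset := setIntegral_condExp (μ := P) hX.comap_le (integrable_upInd hY t)
      (s := X ⁻¹' B) ⟨B, hB, rfl⟩
    rw [setIntegral_congr_ae (g := fun _ => P.real (Y ⁻¹' Set.Ici t)) hXB
      (((condExp_upInd hX hY t).trans hconst).mono fun ω h _ => h), setIntegral_const] at hset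
    have hright : ∫ ω in X ⁻¹' B, upInd Y t ω ∂P = P.real (X ⁻¹' B ∩ Y ⁻¹' Set.Ici t) := by
      have hup : upInd Y t = (Y ⁻¹' Set.Ici t).indicator fun _ => (1 : ℝ) := rfl
      rw [hup, setIntegral_indicator (hY measurableSet_Ici), setIntegral_const, smul_eq_mul,
        mul_one]
    rw [hright, smul_eq_mul] at hset
    rw [← hset, sub_self, abs_zero]
  have hall : ∀ t, P.real (X ⁻¹' B ∩ Y ⁻¹' Set.Ici t)
      = P.real (X ⁻¹' B) * P.real (Y ⁻¹' Set.Ici t) := by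
    intro t
    have hb0 : 0 ≤ P.real (X ⁻¹' B) := measureReal_nonneg
    have hb1 : P.real (X ⁻¹' B) ≤ 1 := measureReal_le_one
    have hle : ∀ T, P.real (X ⁻¹' B ∩ T) ≤ P.real T := fun T =>
      measureReal_mono Set.inter_subset_right
    have hdist : ∀ T, |P.real (X ⁻¹' B ∩ T) - P.real (X ⁻¹' B) * P.real T| ≤ P.real T := by
      intro T
      have h1 : 0 ≤ P.real (X ⁻¹' B ∩ T) := measureReal_nonneg
      have h2 : 0 ≤ P.real T := measureReal_nonneg
      rw [abs_le]
      constructor <;> nlinarith [hle T]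
    have := le_zero_of_ae_eq_zero (μ := P.map Y) (v := fun t => |P.real (X ⁻¹' B ∩ Y ⁻¹' Set.Ici t)
      - P.real (X ⁻¹' B) * P.real (Y ⁻¹' Set.Ici t)|) (fun t => ?_) (fun t a hta => ?_) hgood t
    · exact sub_eq_zero.1 (abs_eq_zero.1 (le_antisymm this (abs_nonneg _)))
    · rw [map_measureReal_apply hY measurableSet_Ici]
      exact hdist _
    · rw [map_measureReal_apply hY measurableSet_Ico]
      have e1 : P.real (Y ⁻¹' Set.Ici t)
          = P.real (Y ⁻¹' Set.Ico t a) + P.real (Y ⁻¹' Set.Ici a) := by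
        have := measureReal_Ici_eq_add (P.map Y) hta
        rwa [map_measureReal_apply hY measurableSet_Ici, map_measureReal_apply hY measurableSet_Ico,
          map_measureReal_apply hY measurableSet_Ici] at this
      have e2 : P.real (X ⁻¹' B ∩ Y ⁻¹' Set.Ici t)
          = P.real (X ⁻¹' B ∩ Y ⁻¹' Set.Ico t a) + P.real (X ⁻¹' B ∩ Y ⁻¹' Set.Ici a) := by
        have := measureReal_Ici_eq_add ((P.restrict (X ⁻¹' B)).map Y) hta
        rw [map_measureReal_apply hY measurableSet_Ici, map_measureReal_apply hY measurableSet_Ico,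
          map_measureReal_apply hY measurableSet_Ici,
          measureReal_restrict_apply (hY measurableSet_Ici),
          measureReal_restrict_apply (hY measurableSet_Ico),
          measureReal_restrict_apply (hY measurableSet_Ici)] at this
        simpa only [Set.inter_comm] using this
      have e3 : P.real (X ⁻¹' B ∩ Y ⁻¹' Set.Ici t) - P.real (X ⁻¹' B) * P.real (Y ⁻¹' Set.Ici t)
          = (P.real (X ⁻¹' B ∩ Y ⁻¹' Set.Ici a) - P.real (X ⁻¹' B) * P.real (Y ⁻¹' Set.Ici a))
            + (P.real (X ⁻¹' B ∩ Y ⁻¹' Set.Ico t a)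
              - P.real (X ⁻¹' B) * P.real (Y ⁻¹' Set.Ico t a)) := by
        rw [e1, e2]; ring
      simp only [e3]
      exact (abs_add_le _ _).trans (add_le_add_right (hdist _) _)
  -- Two finite measures that agree on half-lines are equal.
  have hmeas : (P.restrict (X ⁻¹' B)).map Y = P (X ⁻¹' B) • P.map Y := by
    have hfin : IsFiniteMeasure (P (X ⁻¹' B) • P.map Y) :=
      Measure.smul_finite _ (measure_ne_top _ _)
    refine Measure.ext_of_Ici _ _ fun t => ?_
    rw [Measure.map_apply hY measurableSet_Ici, Measure.restrict_apply (hY measurableSet_Ici),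
      Measure.smul_apply, Measure.map_apply hY measurableSet_Ici, smul_eq_mul, Set.inter_comm]
    have := hall t
    rwa [measureReal_def, measureReal_def, measureReal_def, ← ENNReal.toReal_mul,
      ENNReal.toReal_eq_toReal_iff' (measure_ne_top _ _)
        (ENNReal.mul_ne_top (measure_ne_top _ _) (measure_ne_top _ _))] at this
  have := congrArg (fun ν : Measure ℝ => ν S) hmeas
  simp only [Measure.map_apply hY hS, Measure.restrict_apply (hY hS), Measure.smul_apply,
    smul_eq_mul] at this
  rwa [Set.inter_comm]

lemma varCond_eq_varInd_of_function (hX : Measurable X) {f : ℝ → ℝ} (hf : Measurable f)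
    (h : Y =ᵐ[P] fun ω => f (X ω)) (t : ℝ) : varCond P X Y t = varInd P Y t := by
  have hup : upInd Y t =ᵐ[P] upInd (fun ω => f (X ω)) t := by
    classical
    filter_upwards [h] with ω hω
    simp only [upInd, Set.indicator_apply, Set.mem_ofPred_eq, hω]
  have hmeas : StronglyMeasurable[MeasurableSpace.comap X inferInstance]
      (upInd (fun ω => f (X ω)) t) :=
    StronglyMeasurable.indicator stronglyMeasurable_const
      ⟨f ⁻¹' Set.Ici t, hf measurableSet_Ici, rfl⟩
  have hce : P[upInd Y t | MeasurableSpace.comap X inferInstance]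
      =ᵐ[P] upInd (fun ω => f (X ω)) t := by
    refine (condExp_congr_ae hup).trans ?_
    rw [condExp_of_stronglyMeasurable hX.comap_le hmeas (integrable_upInd (hf.comp hX) t)]
  exact variance_congr (hce.trans hup.symm)

lemma exists_function_of_integral_meanCondVar_eq_zero (hX : Measurable X) (hY : Measurable Y)
    (h0 : ∫ t, meanCondVar P X Y t ∂(P.map Y) = 0) :
    ∃ f : ℝ → ℝ, Measurable f ∧ Y =ᵐ[P] fun ω => f (X ω) := by
  have hpm : IsProbabilityMeasure (P.map Y) := Measure.isProbabilityMeasure_map hY.aemeasurable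
  have hpmX : IsProbabilityMeasure (P.map X) := Measure.isProbabilityMeasure_map hX.aemeasurable
  have hae := (integral_eq_zero_iff_of_nonneg (fun t => meanCondVar_nonneg t)
    (integrable_meanCondVar hX hY)).1 h0
  have hall : ∀ t, meanCondVar P X Y t ≤ 0 := by
    refine le_zero_of_ae_eq_zero (μ := P.map Y) (fun t => ?_) (fun t a hta => ?_) hae
    · rw [← integral_condTail hX hY]
      refine integral_mono (integrable_meanCondVar_integrand t) (integrable_condTail t) fun x => ?_
      obtain ⟨h1, h2⟩ := condTail_mem_Icc (P := P) (X := X) (Y := Y) t x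
      simp only
      nlinarith
    · have hG : (P.map Y).real (Set.Ico t a)
          = ∫ x, (condTail P X Y t x - condTail P X Y a x) ∂(P.map X) := by
        rw [integral_sub (integrable_condTail t) (integrable_condTail a), integral_condTail hX hY,
          integral_condTail hX hY, measureReal_Ici_eq_add _ hta]
        ring
      have hdiff : Integrable (fun x => condTail P X Y t x - condTail P X Y a x) (P.map X) :=
        (integrable_condTail t).sub (integrable_condTail a)
      rw [hG, meanCondVar, meanCondVar, ← integral_add (integrable_meanCondVar_integrand a) hdiff]
      refine integral_mono (integrable_meanCondVar_integrand t)
        ((integrable_meanCondVar_integrand a).add hdiff) fun x => ?_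
      have h1 := condTail_mem_Icc (P := P) (X := X) (Y := Y) t x
      have h2 := condTail_mem_Icc (P := P) (X := X) (Y := Y) a x
      have h3 : condTail P X Y a x ≤ condTail P X Y t x :=
        measureReal_mono (Set.Ici_subset_Ici.2 hta)
      simp only
      nlinarith [h1.1, h1.2, h2.1, h2.2]
  have hq : ∀ᵐ x ∂(P.map X), ∀ r : ℚ,
      condTail P X Y (r : ℝ) x * (1 - condTail P X Y (r : ℝ) x) = 0 := by
    rw [ae_all_iff]
    intro r
    exact (integral_eq_zero_iff_of_nonneg (fun x => (meanCondVar_integrand_mem_Icc (r : ℝ) x).1)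
      (integrable_meanCondVar_integrand (r : ℝ))).1
      (le_antisymm (hall r) (meanCondVar_nonneg _))
  -- The conditional laws are point masses, so the conditional mean is the required function.
  refine ⟨fun x => ∫ y, y ∂(condDistrib Y X P x),
    (StronglyMeasurable.integral_kernel measurable_id.stronglyMeasurable).measurable, ?_⟩
  set f : ℝ → ℝ := fun x => ∫ y, y ∂(condDistrib Y X P x) with hf
  have hfm : Measurable f :=
    (StronglyMeasurable.integral_kernel measurable_id.stronglyMeasurable).measurable
  have hset : MeasurableSet {z : ℝ × ℝ | z.2 = f z.1} :=
    measurableSet_eq_fun measurable_snd (hfm.comp measurable_fst)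
  have hdirac : ∀ᵐ x ∂(P.map X), ∀ᵐ y ∂(condDistrib Y X P x), y = f x := by
    filter_upwards [hq] with x hx
    obtain ⟨c, hc⟩ := exists_ae_eq_of_zero_one (ρ := condDistrib Y X P x) hx
    have hfc : f x = c := by
      rw [hf]
      simp only
      rw [integral_congr_ae hc, integral_const, probReal_univ, one_smul]
    rw [hfc]
    exact hc
  have hjoint := (Measure.ae_compProd_iff (p := fun z : ℝ × ℝ => z.2 = f z.1) hset).2 hdirac
  rw [compProd_map_condDistrib hY.aemeasurable] at hjoint
  exact ae_of_ae_map (hX.prodMk hY).aemeasurable hjoint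

/-- Averaged over the law of `X`, the mean contribution of a pair with equal `x`-values is twice
the mean conditional variance. -/
lemma integral_pairMean_diag (hX : Measurable X) (hY : Measurable Y) :
    ∫ x, pairMean (P.map Y) (condTail P X Y) x x ∂(P.map X)
      = 2 * ∫ t, meanCondVar P X Y t ∂(P.map Y) := by
  have hpm : IsProbabilityMeasure (P.map Y) := Measure.isProbabilityMeasure_map hY.aemeasurable
  have hpmX : IsProbabilityMeasure (P.map X) := Measure.isProbabilityMeasure_map hX.aemeasurable
  have hm : Measurable fun z : ℝ × ℝ => condTail P X Y z.2 z.1 :=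
    measurable_condTail.comp (measurable_snd.prodMk measurable_fst)
  have hint : Integrable (Function.uncurry fun x t =>
      condTail P X Y t x * (1 - condTail P X Y t x)) ((P.map X).prod (P.map Y)) :=
    Integrable.of_mem_Icc 0 1 (hm.mul (hm.const_sub 1)).aemeasurable
      (ae_of_all _ fun z => meanCondVar_integrand_mem_Icc _ _)
  unfold pairMean meanCondVar
  rw [← integral_integral_swap hint, ← integral_const_mul]
  refine integral_congr_ae (ae_of_all _ fun x => ?_)
  simp only
  rw [← integral_const_mul]
  refine integral_congr_ae (ae_of_all _ fun t => ?_)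
  ring

end Limit

/-! ### Convergence of the coefficient -/

/-- If the law of the sample is that of `(X, Y)`, then `ξ_n` converges to
`1 - ∫ E Var(1_{Y ≥ t} | X) dμ(t) / ∫ Var(1_{Y ≥ t}) dμ(t)`, which is `ξ(X, Y)`. -/
lemma tendsto_xiN {Ω : Type*} [MeasurableSpace Ω] {P : Measure Ω} [IsProbabilityMeasure P]
    {X Y : Ω → ℝ} (hX : Measurable X) (hY : Measurable Y)
    (hpos : 0 < ∫ t, varInd P Y t ∂(P.map Y))
    {Ω' : Type*} [MeasurableSpace Ω'] {P' : Measure Ω'} [IsProbabilityMeasure P']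
    {Xs Ys : ℕ → Ω' → ℝ} (hXs : ∀ i, Measurable (Xs i)) (hYs : ∀ i, Measurable (Ys i))
    (hind : iIndepFun (fun i ω => (Xs i ω, Ys i ω)) P')
    (hid : ∀ i, IdentDistrib (fun ω => (Xs i ω, Ys i ω)) (fun ω => (X ω, Y ω)) P' P)
    {σ : (n : ℕ) → Ω' → Equiv.Perm (Fin n)}
    (hσ : ∀ n, IsUniformRearrangement P' (fun ω (i : Fin n) => Xs i ω)
      (fun ω (i : Fin n) => Ys i ω) (σ n)) :
    ∀ᵐ ω ∂P', Tendsto (fun n => xiN (fun i : Fin n => Ys i ω) (σ n ω)) atTop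
      (𝓝 (xi P X Y)) := by
  have hpmX : IsProbabilityMeasure (P.map X) := Measure.isProbabilityMeasure_map hX.aemeasurable
  have hpmY : IsProbabilityMeasure (P.map Y) := Measure.isProbabilityMeasure_map hY.aemeasurable
  have hlawX : ∀ i, P'.map (Xs i) = P.map X := fun i => ((hid i).comp measurable_fst).map_eq
  have hlawY : ∀ i, P'.map (Ys i) = P.map Y := fun i => ((hid i).comp measurable_snd).map_eq
  have hindX : iIndepFun Xs P' := hind.comp (fun _ => Prod.fst) fun _ => measurable_fst
  have hindY : iIndepFun Ys P' := hind.comp (fun _ => Prod.snd) fun _ => measurable_snd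
  have hlaw : ∀ i, P'.map (fun ω => (Xs i ω, Ys i ω)) = P.map X ⊗ₘ condDistrib Y X P := fun i => by
    rw [(hid i).map_eq, compProd_map_condDistrib hY.aemeasurable]
  have hinc : ∀ᵐ ω ∂P', ∀ n, IsIncreasingRearrangement (fun i : Fin n => Xs i ω) (σ n ω) :=
    ae_all_iff.2 fun n => ae_isIncreasingRearrangement
      (measurable_pi_lambda _ fun i : Fin n => hXs i)
      (measurable_pi_lambda _ fun i : Fin n => hYs i) (hσ n)
  have hmean := tendsto_adjSum_pairMean (μ := P.map Y) hXs hindX hlawX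
    (fun n p => (hσ n).measurableSet_eq p) hinc
    (measurable_condTail (P := P) (X := X) (Y := Y)) condTail_mem_Icc
  have hconc := tendsto_adjSum_sub_pairMean (μ := P.map Y) hXs hYs hind hlaw
    (q := condTail P X Y) (fun _ _ => rfl) measurable_condTail hσ
  have hgc := tendsto_countLe_uniform hYs hindY hlawY
  have hden := tendsto_sum_rankGe hYs hindY hlawY σ
  rw [integral_pairMean_diag hX hY] at hmean
  filter_upwards [hmean, hconc, hgc, hden] with ω h1 h2 h3 h4
  set N : ℝ := ∫ t, meanCondVar P X Y t ∂(P.map Y) with hN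
  set D : ℝ := ∫ t, varInd P Y t ∂(P.map Y) with hD
  have h4' : ∫ t, (P.map Y).real (Set.Ici t) * (1 - (P.map Y).real (Set.Ici t)) ∂(P.map Y) = D := by
    rw [hD]
    exact integral_congr_ae (ae_of_all _ fun t => (varInd_eq hY t).symm)
  rw [h4'] at h4
  -- The sum over neighbours, with ranks replaced by the distribution function of `Y`.
  have h5 : Tendsto (fun n : ℕ => adjSum (fun i j : Fin n =>
      |(P.map Y).real (Set.Iic (Ys (σ n ω j) ω)) - (P.map Y).real (Set.Iic (Ys (σ n ω i) ω))|) / n)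
      atTop (𝓝 (2 * N)) := by
    have := h2.add h1
    rw [zero_add] at this
    refine this.congr fun n => ?_
    rw [← add_div, sub_add_cancel]
  have h6 : Tendsto (fun n : ℕ => adjSum (fun i j : Fin n =>
      |(rankLe (fun k : Fin n => Ys k ω) (σ n ω) j : ℝ)
        - rankLe (fun k : Fin n => Ys k ω) (σ n ω) i|) / (n : ℝ) ^ 2) atTop (𝓝 (2 * N)) := by
    have hdiff : Tendsto (fun n : ℕ => adjSum (fun i j : Fin n =>
        |(rankLe (fun k : Fin n => Ys k ω) (σ n ω) j : ℝ)
          - rankLe (fun k : Fin n => Ys k ω) (σ n ω) i|) / (n : ℝ) ^ 2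
        - adjSum (fun i j : Fin n => |(P.map Y).real (Set.Iic (Ys (σ n ω j) ω))
          - (P.map Y).real (Set.Iic (Ys (σ n ω i) ω))|) / n) atTop (𝓝 0) := by
      rw [Metric.tendsto_atTop]
      intro ε hε
      obtain ⟨M, hM⟩ := eventually_atTop.1 (h3 (ε / 4) (by positivity))
      refine ⟨M, fun n hn => ?_⟩
      rw [Real.dist_eq, sub_zero]
      refine (abs_adjSum_rankLe_sub_le (y := fun k : Fin n => Ys k ω)
        (F := fun t => (P.map Y).real (Set.Iic t)) (ε := ε / 4) (by positivity)
        (hM n hn) (σ n ω)).trans_lt ?_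
      linarith
    simpa using hdiff.add h5
  have hxi : xi P X Y = 1 - 2 * N / (2 * D) := by
    rw [xi, integral_varCond hX hY, ← hD, ← hN]
    field_simp
  have h7 := (h6.div (h4.const_mul 2) (by positivity)).const_sub 1
  rw [hxi]
  refine h7.congr' ?_
  filter_upwards [eventually_gt_atTop 0] with n hn
  have hn' : (n : ℝ) ≠ 0 := by exact_mod_cast hn.ne'
  have hdef : xiN (fun i : Fin n => Ys i ω) (σ n ω) = 1 - (n * adjSum (fun i j : Fin n =>
      |(rankLe (fun k : Fin n => Ys k ω) (σ n ω) j : ℝ)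
        - rankLe (fun k : Fin n => Ys k ω) (σ n ω) i|))
      / (2 * ∑ i : Fin n, (rankGe (fun j : Fin n => Ys j ω) (σ n ω) i : ℝ)
        * (n - rankGe (fun j : Fin n => Ys j ω) (σ n ω) i)) := rfl
  rw [hdef]
  simp only [Pi.div_apply]
  congr 1
  have halg : ∀ a b : ℝ, a / (n : ℝ) ^ 2 / (2 * (b / (n : ℝ) ^ 3)) = n * a / (2 * b) := by
    intro a b
    rcases eq_or_ne b 0 with rfl | hb
    · simp
    · field_simp
  exact halg _ _

end RankCorr

theorem theorem1p1 {Ω : Type*} [MeasurableSpace Ω] (P : Measure Ω) [IsProbabilityMeasure P]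
    (X Y : Ω → ℝ) (hX : Measurable X) (hY : Measurable Y)
    (hYc : ¬ ∃ c : ℝ, Y =ᵐ[P] fun _ => c) :
    -- the ratio defining `ξ(X, Y)` is meaningful
    (Integrable (RankCorr.varCond P X Y) (P.map Y) ∧
      Integrable (RankCorr.varInd P Y) (P.map Y) ∧
      0 < ∫ t, RankCorr.varInd P Y t ∂(P.map Y)) ∧
    -- `ξ_n` converges almost surely to `ξ(X, Y)` along every i.i.d. sample
    (∀ {Ω' : Type*} [MeasurableSpace Ω'] (P' : Measure Ω') [IsProbabilityMeasure P']
      (Xs Ys : ℕ → Ω' → ℝ),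
      (∀ i, Measurable (Xs i)) → (∀ i, Measurable (Ys i)) →
      iIndepFun (fun i ω => (Xs i ω, Ys i ω)) P' →
      (∀ i, IdentDistrib (fun ω => (Xs i ω, Ys i ω)) (fun ω => (X ω, Y ω)) P' P) →
      ∀ σ : (n : ℕ) → Ω' → Equiv.Perm (Fin n),
      (∀ n, RankCorr.IsUniformRearrangement P'
        (fun ω (i : Fin n) => Xs i ω) (fun ω (i : Fin n) => Ys i ω) (σ n)) →
      ∀ᵐ ω ∂P', Filter.Tendsto
        (fun n => RankCorr.xiN (fun i : Fin n => Ys i ω) (σ n ω))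
        Filter.atTop (nhds (RankCorr.xi P X Y))) ∧
    RankCorr.xi P X Y ∈ Set.Icc (0 : ℝ) 1 ∧
    (RankCorr.xi P X Y = 0 ↔ IndepFun X Y P) ∧
    (RankCorr.xi P X Y = 1 ↔ ∃ f : ℝ → ℝ, Measurable f ∧ Y =ᵐ[P] fun ω => f (X ω)) := by
  have hpos := RankCorr.integral_varInd_pos hY hYc
  have hsplit := RankCorr.integral_varCond (P := P) hX hY
  have hcond : 0 ≤ ∫ t, RankCorr.varCond P X Y t ∂(P.map Y) :=
    integral_nonneg fun t => RankCorr.varCond_nonneg (P := P) (X := X) (Y := Y) t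
  have hmean : 0 ≤ ∫ t, RankCorr.meanCondVar P X Y t ∂(P.map Y) :=
    integral_nonneg fun t => RankCorr.meanCondVar_nonneg (P := P) (X := X) (Y := Y) t
  refine ⟨⟨RankCorr.integrable_varCond hX hY, RankCorr.integrable_varInd hY, hpos⟩, ?_, ?_, ?_, ?_⟩
  · intro Ω' _ P' _ Xs Ys hXs hYs hind hid σ hσ
    exact RankCorr.tendsto_xiN hX hY hpos hXs hYs hind hid hσ
  · exact ⟨div_nonneg hcond hpos.le, div_le_one_of_le₀ (by linarith) hpos.le⟩
  · constructor
    · intro h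
      exact RankCorr.indepFun_of_integral_varCond_eq_zero hX hY
        ((div_eq_zero_iff.1 h).resolve_right hpos.ne')
    · intro h
      rw [RankCorr.xi, funext (RankCorr.varCond_eq_zero_of_indepFun hX hY h), integral_zero,
        zero_div]
  · constructor
    · intro h
      have := (div_eq_one_iff_eq hpos.ne').1 h
      exact RankCorr.exists_function_of_integral_meanCondVar_eq_zero hX hY (by linarith)
    · rintro ⟨f, hf, hfY⟩
      rw [RankCorr.xi, funext (RankCorr.varCond_eq_varInd_of_function hX hf hfY)]
      exact div_self hpos.ne'
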